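/- For $N\ge 1$ let $f_N:\mathbb{R}^N\to\mathbb{R}\cup\{\infty\}$ be $f_N(x)=x(N)-x(1)$ if $x(1)\le x(2)\le\dots\le x(N)$, and $f_N(x)=\infty$ otherwise. For $x_0\in\mathbb{R}^N$ let $$\mathcal{D}(f_N,x_0)=\bigcup_{\tau>0}\{y\in\mathbb{R}^N: f_N(x_0+\tau y)\le f_N(x_0)\}$$ be the descent cone of $f_N$ at $x_0$. For a closed convex cone $C\subseteq\mathbb{R}^N$ let $\delta(C)=\mathbb{E}\,\|\Pi_C(g)\|^2$ be its statistical dimension, where $g$ is a standard Gaussian vector in $\mathbb{R}^N$ and $\Pi_C$ is the Euclidean projection onto $C$. The change points of a monotone signal $x_0\in\mathbb{R}^N$ are the indices $i\in\{2,\dots,N\}$ with $x_0(i)>x_0(i-1)$. For each $N$ and each $S\subseteq\{2,\dots,N\}$ let $x_S\in\mathbb{R}^N$ be any monotone signal whose set of change points is exactly $S$. **Theorem.** Let $0<\varepsilon<1$, and let $N,k\to\infty$ along integers with $k/N\to\varepsilon$ (in particular this covers $k/N=\varepsilon$). Then the statistical dimension, normalized by $N$ and averaged over the choice of the $k$ change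 points uniformly at random, converges: $$\binom{N-1}{k}^{-1}\sum_{\substack{S\subseteq\{2,\dots,N\}\\ |S|=k}}\frac{1}{N}\,\delta\bigl(\mathcal{D}(f_N,x_S)\bigr)\;\longrightarrow\;\frac{\varepsilon\log(1/\varepsilon)}{1-\varepsilon}.$$ This holds for every choice of the signals $x_S$. -/

import Mathlib

open Filter Topology MeasureTheory ProbabilityTheory

noncomputable section

/-- The total variation norm restricted to monotone signals: `x(N) - x(1)` if
`x(1) ≤ x(2) ≤ … ≤ x(N)`, and `∞` otherwise. Coordinates are numbered from `0` in `Fin N`.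
The empty signal gets the value `0`. -/
def monotoneTV : (N : ℕ) → EuclideanSpace ℝ (Fin N) → EReal
  | 0, _ => 0
  | N + 1, x =>
    open Classical in
    if Monotone (fun i => x i) then ((x (Fin.last N) - x 0 : ℝ) : EReal) else ⊤

/-- The descent cone of `f` at `x`: `⋃_{τ > 0} {y : f (x + τ y) ≤ f x}`. -/
def descentCone {E : Type*} [AddCommGroup E] [Module ℝ E] (f : E → EReal) (x : E) : Set E :=
  ⋃ τ ∈ Set.Ioi (0 : ℝ), {y : E | f (x + τ • y) ≤ f x}

/-- `p` is a point of `C` nearest to `g`. -/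
def IsNearestPoint {E : Type*} [NormedAddCommGroup E] (C : Set E) (g p : E) : Prop :=
  p ∈ C ∧ ∀ q ∈ C, ‖g - p‖ ≤ ‖g - q‖

/-- Metric projection onto `C` (the value `0` is used if there is no nearest point, which does not
happen when `C` is nonempty, closed and convex in a Euclidean space). -/
def metricProj {E : Type*} [NormedAddCommGroup E] (C : Set E) (g : E) : E :=
  open Classical in if h : ∃ p, IsNearestPoint C g p then h.choose else 0

/-- On a nonempty closed convex set `metricProj` is the unique nearest point. -/
theorem isNearestPoint_iff_eq_metricProj {E : Type*} [NormedAddCommGroup E]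
    [InnerProductSpace ℝ E] [CompleteSpace E] {C : Set E} (hne : C.Nonempty) (hcl : IsClosed C)
    (hco : Convex ℝ C) (g p : E) : IsNearestPoint C g p ↔ p = metricProj C g := by
  have key : ∀ q, IsNearestPoint C g q → ∀ w ∈ C, inner ℝ (g - q) (w - q) ≤ 0 := by
    intro q hq
    refine (norm_eq_iInf_iff_real_inner_le_zero hco hq.1).1 ?_
    have : Nonempty C := ⟨⟨q, hq.1⟩⟩
    refine le_antisymm (le_ciInf fun w => hq.2 w w.2) ?_
    exact ciInf_le ⟨0, by rintro _ ⟨w, rfl⟩; exact norm_nonneg _⟩ (⟨q, hq.1⟩ : C)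
  have uniq : ∀ q r, IsNearestPoint C g q → IsNearestPoint C g r → q = r := by
    intro q r hq hr
    have h1 := key q hq r hr.1
    have h2 := key r hr q hq.1
    have h3 : inner ℝ (r - q) (r - q) ≤ 0 := by
      have e : inner ℝ (r - q) (r - q)
          = inner ℝ (g - q) (r - q) + inner ℝ (g - r) (q - r) := by
        have : q - r = -(r - q) := by abel
        rw [this, inner_neg_right, ← sub_eq_add_neg, ← inner_sub_left]
        congr 1
        abel
      rw [e]; linarith
    have h4 : r - q = 0 := real_inner_self_nonpos.1 h3
    exact (sub_eq_zero.1 h4).symm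
  have ex : ∃ q, IsNearestPoint C g q := by
    obtain ⟨v, hv, h⟩ := exists_norm_eq_iInf_of_complete_convex hne hcl.isComplete hco g
    refine ⟨v, hv, fun w hw => ?_⟩
    rw [h]
    exact ciInf_le ⟨0, by rintro _ ⟨w, rfl⟩; exact norm_nonneg _⟩ (⟨w, hw⟩ : C)
  have spec : IsNearestPoint C g (metricProj C g) := by
    unfold metricProj
    rw [dif_pos ex]
    exact ex.choose_spec
  exact ⟨fun h => uniq _ _ h spec, fun h => h ▸ spec⟩

/-- The statistical dimension `δ(C) = 𝔼 ‖Π_C(g)‖²` for a standard Gaussian vector `g` in `ℝ^N`. -/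
def statDim {N : ℕ} (C : Set (EuclideanSpace ℝ (Fin N))) : ℝ :=
  ∫ g, ‖metricProj C g‖ ^ 2 ∂(stdGaussian (EuclideanSpace ℝ (Fin N)))

/-- The set of change points of a signal: the positions `i`, other than the first one, with
`x(i) > x(i-1)`. -/
def changePoints {N : ℕ} (x : EuclideanSpace ℝ (Fin N)) : Finset (Fin N) :=
  open Classical in
  Finset.univ.filter (fun i => ∃ j : Fin N, (j : ℕ) + 1 = i ∧ x j < x i)

/-- The positions that can be change points: all but the first one. -/
def possibleChangePoints (N : ℕ) : Finset (Fin N) :=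
  Finset.univ.filter (fun i => 0 < (i : ℕ))

/-- Average, over all `k`-element sets `S` of possible change points, with equal weights, of the
statistical dimension divided by `N` of the descent cone of `monotoneTV` at the signal `x S`. -/
def averageNormalizedSD (N k : ℕ) (x : Finset (Fin N) → EuclideanSpace ℝ (Fin N)) : ℝ :=
  (∑ S ∈ (possibleChangePoints N).powersetCard k,
      statDim (descentCone (monotoneTV N) (x S)) / (N : ℝ)) /
    (((possibleChangePoints N).powersetCard k).card : ℝ)

end

/-! The first position is never a change point, and the bound on the total rise turns into the
condition that the last entry of `y` is at most the first. So the descent cone consists of the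
signals that are nondecreasing around the whole cycle except across `S`
(`descentCone_monotoneTV_eq`). It is a product of monotone cones, one for each block from an element
of `S` up to the next, and its statistical dimension is the sum over the blocks.

On a block of length `l` the projection is isotonic regression: the slopes of the greatest convex
minorant of the walk of partial sums. Optimality is summation by parts (`minorantSlope_polar`,
`minorantSlope_orthogonal`). Almost surely all chords have different slopes, and then the squared
norm is the sum over the faces of squared rise over length. The squared rises of the faces of a
fixed length `m` have total mean exactly `1` (`sum_integral_faceTerm`). Indeed, exchangeability
brings the `m` steps to the front, and the chord is a face iff the block stays above its own chord
and is inserted where the tilted rest of the walk is minimal. Exactly one insertion point qualifies,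
and exactly one of the `m` rotations of the block does, which leaves `1 / m` times the second moment
`m` of the block sum. Dividing by `m` and summing gives the harmonic number of `l`
(`integral_faceSum`).

Hence the statistical dimension is the sum over `j` of the number of blocks longer than `j`, divided
by `j + 1`. A block longer than `j` is an element of `S` followed by `j` non-elements, so the
normalized mean count tends to `ε (1 - ε) ^ j` (`tendsto_meanLongBlocks`). The windows of such
blocks are disjoint, so the normalized count is at most `1 / (j + 1)`. Dominated convergence and the
logarithm series finish the proof. -/

noncomputable section

/-! ### Faces of the greatest convex minorant of a walk -/

/-- The walk with increments `h`. -/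
def walk (h : ℕ → ℝ) (t : ℕ) : ℝ := ∑ a ∈ Finset.range t, h a

/-- The chord of the walk from `i` to `j` lies below the walk on `[0, l]`, that is, it is contained
in a face of the greatest convex minorant. -/
def IsFace (l : ℕ) (h : ℕ → ℝ) (i j : ℕ) : Prop :=
  i < j ∧ j ≤ l ∧ ∀ t ≤ l,
    (walk h j - walk h i) * ((t : ℝ) - i) ≤ (walk h t - walk h i) * ((j : ℝ) - i)

/-- Different chords of the walk have different slopes. -/
def DistinctSlopes (h : ℕ → ℝ) : Prop :=
  ∀ a b c d : ℕ, a < b → c < d → (a, b) ≠ (c, d) →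
    (walk h b - walk h a) * ((d : ℝ) - c) ≠ (walk h d - walk h c) * ((b : ℝ) - a)

/-- The sum over the faces of the convex minorant of squared rise over length. -/
def faceSum (l : ℕ) (h : ℕ → ℝ) : ℝ :=
  open Classical in
  ∑ m ∈ Finset.range l, ∑ i ∈ Finset.range (l - m),
    if IsFace l h i (i + (m + 1)) then
      (walk h (i + (m + 1)) - walk h i) ^ 2 / ((m : ℝ) + 1) else 0

theorem walk_succ (h : ℕ → ℝ) (t : ℕ) : walk h (t + 1) = walk h t + h t := by
  simp [walk, Finset.sum_range_succ]

theorem walk_zero (h : ℕ → ℝ) : walk h 0 = 0 := by simp [walk]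

/-- Among the chords that span step `a`, take the one that is lowest above the middle of the step. A
point of the walk below its line could replace one endpoint and give a lower chord. -/
theorem exists_isFace (l : ℕ) (h : ℕ → ℝ) (a : ℕ) (ha : a < l) :
    ∃ i j, i ≤ a ∧ a < j ∧ IsFace l h i j := by
  -- The abscissa `a + 1 / 2` lies strictly inside every competing chord, so a replacement of either
  -- endpoint lowers the height strictly.
  let height : ℕ × ℕ → ℝ := fun p =>
    walk h p.1 + (walk h p.2 - walk h p.1) / ((p.2 : ℝ) - p.1) * ((a : ℝ) + 1 / 2 - p.1)
  obtain ⟨⟨i, j⟩, hm, hmin⟩ := Finset.exists_min_image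
    (Finset.range (a + 1) ×ˢ Finset.Ioc a l) height ⟨(0, l), by simp [ha]⟩
  simp only [Finset.mem_product, Finset.mem_range, Finset.mem_Ioc] at hm
  refine ⟨i, j, by omega, hm.2.1, by omega, hm.2.2, fun t ht => ?_⟩
  have hia : (i : ℝ) ≤ a := by exact_mod_cast Nat.lt_succ_iff.mp hm.1
  have haj : (a : ℝ) + 1 ≤ j := by exact_mod_cast hm.2.1
  have hij : (0 : ℝ) < j - i := by linarith
  by_contra hcon
  push Not at hcon
  set v := (walk h j - walk h i) / ((j : ℝ) - i) with hv
  have hvm : walk h j - walk h i = v * ((j : ℝ) - i) := by rw [hv]; field_simp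
  have hlow : walk h t - walk h i < v * ((t : ℝ) - i) := by
    rw [hvm] at hcon
    have : (walk h t - walk h i) * ((j : ℝ) - i) < v * ((t : ℝ) - i) * ((j : ℝ) - i) := by
      linarith [mul_right_comm v ((j : ℝ) - i) ((t : ℝ) - i)]
    exact lt_of_mul_lt_mul_right this hij.le
  rcases Nat.lt_or_ge a t with hat | hat
  · have h1 := hmin (i, t) (by simp; omega)
    have hta : (a : ℝ) + 1 ≤ t := by exact_mod_cast hat
    have hti : (0 : ℝ) < t - i := by linarith
    have hlt : (walk h t - walk h i) / ((t : ℝ) - i) < v := by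
      rw [div_lt_iff₀ hti]; exact hlow
    have := mul_lt_mul_of_pos_right hlt (show (0 : ℝ) < a + 1 / 2 - i by linarith)
    simp only [height] at h1
    linarith
  · have h1 := hmin (t, j) (by simp; omega)
    have hta : (t : ℝ) ≤ a := by exact_mod_cast hat
    have hti : (0 : ℝ) < j - t := by linarith
    have hlt : v < (walk h j - walk h t) / ((j : ℝ) - t) := by
      rw [lt_div_iff₀ hti]; linarith [mul_sub v (j : ℝ) t, mul_sub v (j : ℝ) i, mul_sub v (t : ℝ) i]
    have := mul_lt_mul_of_pos_right hlt (show (0 : ℝ) < j - (a + 1 / 2) by linarith)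
    simp only [height] at h1
    have e : walk h t + (walk h j - walk h t) / ((j : ℝ) - t) * ((a : ℝ) + 1 / 2 - t)
      = walk h j - (walk h j - walk h t) / ((j : ℝ) - t) * (j - ((a : ℝ) + 1 / 2)) := by
      field_simp; ring
    have e2 : walk h i + v * ((a : ℝ) + 1 / 2 - i)
      = walk h j - v * (j - ((a : ℝ) + 1 / 2)) := by
      linarith [mul_sub v (j : ℝ) i, mul_sub v ((a : ℝ) + 1 / 2) i, mul_sub v (j : ℝ) ((a : ℝ) + 1 / 2)]
    linarith

/-- The slope of a chord. -/
def chordSlope (h : ℕ → ℝ) (i j : ℕ) : ℝ := (walk h j - walk h i) / ((j : ℝ) - i)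

theorem IsFace.sub_eq {l : ℕ} {h : ℕ → ℝ} {i j : ℕ} (H : IsFace l h i j) :
    walk h j - walk h i = chordSlope h i j * ((j : ℝ) - i) := by
  have : (i : ℝ) < j := by exact_mod_cast H.1
  rw [chordSlope, div_mul_cancel₀ _ (by linarith)]

theorem IsFace.le {l : ℕ} {h : ℕ → ℝ} {i j : ℕ} (H : IsFace l h i j) {t : ℕ} (ht : t ≤ l) :
    walk h i + chordSlope h i j * ((t : ℝ) - i) ≤ walk h t := by
  have hij : (i : ℝ) < j := by exact_mod_cast H.1
  have := H.2.2 t ht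
  rw [H.sub_eq, mul_right_comm] at this
  linarith [le_of_mul_le_mul_right this (by linarith)]

/-- Touching points of supporting lines are ordered like their slopes. -/
theorem IsFace.le_of_slope_lt {l : ℕ} {h : ℕ → ℝ} {i j i' j' : ℕ} (H : IsFace l h i j)
    (H' : IsFace l h i' j') (hlt : chordSlope h i j < chordSlope h i' j') : j ≤ i' := by
  have h1 := H.le (t := i') (by have := H'.1; have := H'.2.1; omega)
  have h2 := H'.le H.2.1
  have h3 := H.sub_eq
  have : (chordSlope h i' j' - chordSlope h i j) * ((j : ℝ) - i') ≤ 0 := by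
    linear_combination h1 + h2 + h3
  have : (j : ℝ) ≤ i' := by
    by_contra hc
    push Not at hc
    nlinarith [mul_pos (sub_pos.2 hlt) (sub_pos.2 hc)]
  exact_mod_cast this

theorem IsFace.slope_eq {l : ℕ} {h : ℕ → ℝ} {i j i' j' : ℕ} (H : IsFace l h i j)
    (H' : IsFace l h i' j') (h1 : i < j') (h2 : i' < j) :
    chordSlope h i j = chordSlope h i' j' := by
  rcases lt_trichotomy (chordSlope h i j) (chordSlope h i' j') with h | h | h
  · have := H.le_of_slope_lt H' h; omega
  · exact h
  · have := H'.le_of_slope_lt H h; omega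

/-! ### The convex minorant through its slopes -/

/-- The slope of the convex minorant of the walk above the `a`-th step. -/
def minorantSlope (l : ℕ) (h : ℕ → ℝ) (a : ℕ) : ℝ :=
  if ha : a < l then
    chordSlope h (exists_isFace l h a ha).choose (exists_isFace l h a ha).choose_spec.choose
  else 0

/-- Overlapping faces have equal slopes, so the face chosen in the definition does not matter. -/
theorem IsFace.minorantSlope_eq {l : ℕ} {h : ℕ → ℝ} {i j : ℕ} (H : IsFace l h i j) {a : ℕ}
    (h1 : i ≤ a) (h2 : a < j) : minorantSlope l h a = chordSlope h i j := by
  have ha : a < l := lt_of_lt_of_le h2 H.2.1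
  rw [minorantSlope, dif_pos ha]
  obtain ⟨h3, h4, h5⟩ := (exists_isFace l h a ha).choose_spec.choose_spec
  exact h5.slope_eq H (by omega) (by omega)

theorem minorantSlope_mono {l : ℕ} {h : ℕ → ℝ} {a b : ℕ} (hab : a ≤ b) (hb : b < l) :
    minorantSlope l h a ≤ minorantSlope l h b := by
  obtain ⟨i, j, h1, h2, H⟩ := exists_isFace l h a (by omega)
  obtain ⟨i', j', h1', h2', H'⟩ := exists_isFace l h b hb
  rw [H.minorantSlope_eq h1 h2, H'.minorantSlope_eq h1' h2']
  by_contra hc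
  push Not at hc
  have := H'.le_of_slope_lt H hc
  omega

theorem IsFace.walk_minorantSlope {l : ℕ} {h : ℕ → ℝ} {i j : ℕ} (H : IsFace l h i j) {t : ℕ}
    (h1 : i ≤ t) (h2 : t ≤ j) : walk (minorantSlope l h) t =
      walk (minorantSlope l h) i + chordSlope h i j * ((t : ℝ) - i) := by
  induction t, h1 using Nat.le_induction with
  | base => simp
  | succ t hit ih =>
    rw [walk_succ, ih (by omega), H.minorantSlope_eq hit (by omega)]
    push_cast; ring

/-- Strong induction through a face `(i', j')` that covers the step before `i`. Either it ends at
`i`, or it overlaps the given face; in that case the slopes agree and the two supporting lines bound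
the walk at `i` from both sides. -/
theorem IsFace.walk_left_eq {l : ℕ} {h : ℕ → ℝ} : ∀ {i j : ℕ}, IsFace l h i j →
    walk (minorantSlope l h) i = walk h i := by
  intro i
  induction i using Nat.strong_induction_on with
  | _ i ih =>
  intro j H
  rcases Nat.eq_zero_or_pos i with rfl | hi
  · simp [walk_zero]
  have hil : i < l := lt_of_lt_of_le H.1 H.2.1
  obtain ⟨i', j', h1, h2, H'⟩ := exists_isFace l h (i - 1) (by omega)
  have e := H'.walk_minorantSlope (t := i) (by omega) (by omega)
  rw [e, ih i' (by omega) H']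
  rcases Nat.lt_or_ge i j' with h3 | h3
  · have hs := H.slope_eq H' h3 (by have := H.1; omega)
    apply le_antisymm (H'.le hil.le)
    have := H.le (t := i') (by omega)
    rw [hs] at this
    linarith
  · have : j' = i := by omega
    subst this
    linarith [H'.sub_eq]

theorem walk_minorantSlope_le {l : ℕ} {h : ℕ → ℝ} {t : ℕ} (ht : t ≤ l) :
    walk (minorantSlope l h) t ≤ walk h t := by
  rcases Nat.eq_zero_or_pos t with rfl | hi
  · simp [walk_zero]
  obtain ⟨i, j, h1, h2, H⟩ := exists_isFace l h (t - 1) (by omega)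
  rw [H.walk_minorantSlope (t := t) (by omega) (by omega), H.walk_left_eq]
  exact H.le ht

theorem IsFace.walk_right_eq {l : ℕ} {h : ℕ → ℝ} {i j : ℕ} (H : IsFace l h i j) :
    walk (minorantSlope l h) j = walk h j := by
  rw [H.walk_minorantSlope H.1.le le_rfl, H.walk_left_eq]
  linarith [H.sub_eq]

theorem walk_minorantSlope_end {l : ℕ} {h : ℕ → ℝ} :
    walk (minorantSlope l h) l = walk h l := by
  rcases Nat.eq_zero_or_pos l with rfl | hi
  · simp [walk_zero]
  obtain ⟨i, j, h1, h2, H⟩ := exists_isFace l h (l - 1) (by omega)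
  have := H.2.1
  obtain rfl : j = l := by omega
  exact H.walk_right_eq

/-! ### Optimality of the minorant slopes for isotonic regression -/

/-- Summation by parts. -/
theorem sum_mul_eq_walk (d q : ℕ → ℝ) (l : ℕ) :
    ∑ t ∈ Finset.range (l + 1), d t * q t =
      walk d (l + 1) * q l - ∑ t ∈ Finset.range l, walk d (t + 1) * (q (t + 1) - q t) := by
  induction l with
  | zero => simp [walk]
  | succ l ih =>
    rw [Finset.sum_range_succ, ih, Finset.sum_range_succ _ l, walk_succ d (l + 1)]
    ring

theorem walk_sub (h p : ℕ → ℝ) (t : ℕ) : walk (fun a => h a - p a) t = walk h t - walk p t := by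
  simp [walk, Finset.sum_sub_distrib]

/-- By parts: the boundary term vanishes because walk and minorant end at the same point, and each
other term is a nonnegative gap times a nonnegative increment of `q`. -/
theorem minorantSlope_polar (l : ℕ) (h q : ℕ → ℝ) (hq : ∀ t, t + 1 < l → q t ≤ q (t + 1)) :
    ∑ t ∈ Finset.range l, (h t - minorantSlope l h t) * q t ≤ 0 := by
  rcases l with _ | l
  · simp
  rw [sum_mul_eq_walk (fun t => h t - minorantSlope (l + 1) h t), walk_sub, walk_minorantSlope_end]
  simp only [sub_self, zero_mul, zero_sub, Left.neg_nonpos_iff]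
  refine Finset.sum_nonneg fun t ht => ?_
  rw [Finset.mem_range] at ht
  rw [walk_sub]
  exact mul_nonneg (sub_nonneg.2 (walk_minorantSlope_le (by omega)))
    (sub_nonneg.2 (hq t (by omega)))

/-- By parts again: at each interior point either the slope does not change or the minorant touches
the walk. -/
theorem minorantSlope_orthogonal (l : ℕ) (h : ℕ → ℝ) :
    ∑ t ∈ Finset.range l, (h t - minorantSlope l h t) * minorantSlope l h t = 0 := by
  rcases l with _ | l
  · simp
  rw [sum_mul_eq_walk (fun t => h t - minorantSlope (l + 1) h t), walk_sub, walk_minorantSlope_end]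
  simp only [sub_self, zero_mul, zero_sub, neg_eq_zero]
  refine Finset.sum_eq_zero fun t ht => ?_
  rw [Finset.mem_range] at ht
  obtain ⟨i, j, h1, h2, H⟩ := exists_isFace (l + 1) h t (by omega)
  rw [walk_sub]
  rcases Nat.lt_or_ge (t + 1) j with h3 | h3
  · rw [H.minorantSlope_eq h1 h2, H.minorantSlope_eq (by omega) h3]
    simp
  · obtain rfl : j = t + 1 := by omega
    rw [H.walk_right_eq]; simp

theorem DistinctSlopes.face_unique {l : ℕ} {h : ℕ → ℝ} (hg : DistinctSlopes h) {i j i' j' : ℕ}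
    (H : IsFace l h i j) (H' : IsFace l h i' j') (h1 : i < j') (h2 : i' < j) :
    (i, j) = (i', j') := by
  by_contra hne
  refine hg i j i' j' H.1 H'.1 hne ?_
  rw [H.sub_eq, H'.sub_eq, H.slope_eq H' h1 h2]
  ring

/-- Distinct slopes put exactly one face above each step. A face of length `m + 1` then contributes
its squared slope `m + 1` times, which is squared rise over length. -/
theorem DistinctSlopes.sum_sq_minorantSlope {l : ℕ} {h : ℕ → ℝ} (hg : DistinctSlopes h) :
    ∑ t ∈ Finset.range l, minorantSlope l h t ^ 2 = faceSum l h := by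
  classical
  have key : ∀ t ∈ Finset.range l, minorantSlope l h t ^ 2 =
      ∑ m ∈ Finset.range l, ∑ i ∈ Finset.range (l - m),
        if IsFace l h i (i + (m + 1)) ∧ i ≤ t ∧ t < i + (m + 1) then
          chordSlope h i (i + (m + 1)) ^ 2 else 0 := by
    intro t ht
    rw [Finset.mem_range] at ht
    obtain ⟨i, j, h1, h2, H⟩ := exists_isFace l h t ht
    have hij := H.1
    have hjl := H.2.1
    obtain ⟨m, rfl⟩ : ∃ m, j = i + (m + 1) := ⟨j - i - 1, by omega⟩
    rw [Finset.sum_eq_single_of_mem m (by simp; omega), Finset.sum_eq_single_of_mem i (by simp; omega),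
      if_pos ⟨H, h1, h2⟩, H.minorantSlope_eq h1 h2]
    · intro i' _ hne
      refine if_neg fun hc => hne ?_
      have := hg.face_unique H hc.1 (by omega) (by omega)
      simp at this; omega
    · intro m' _ hne
      refine Finset.sum_eq_zero fun i' _ => if_neg fun hc => hne ?_
      have := hg.face_unique H hc.1 (by omega) (by omega)
      simp at this; omega
  rw [Finset.sum_congr rfl key, Finset.sum_comm, faceSum]
  refine Finset.sum_congr rfl fun m _ => ?_
  rw [Finset.sum_comm]
  refine Finset.sum_congr rfl fun i _ => ?_
  split_ifs with H
  · simp only [H, true_and]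
    rw [← Finset.sum_filter]
    have : (Finset.range l).filter (fun t => i ≤ t ∧ t < i + (m + 1)) =
        Finset.Ico i (i + (m + 1)) := by
      ext t
      have := H.2.1
      simp only [Finset.mem_filter, Finset.mem_range, Finset.mem_Ico]; omega
    rw [this, Finset.sum_const, Nat.card_Ico, nsmul_eq_mul, H.sub_eq]
    have : ((m : ℝ) + 1) ≠ 0 := by positivity
    push_cast
    have e : ((i + (m + 1) - i : ℕ) : ℝ) = m + 1 := by
      rw [Nat.add_sub_cancel_left]; push_cast; rfl
    rw [e]; field_simp; ring
  · simp [H]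

/-! ### Gaussian sequences and almost sure genericity -/

/-- The law of a sequence of independent standard Gaussian variables. -/
def gaussianSeq : Measure (ℕ → ℝ) := Measure.infinitePi fun _ => gaussianReal 0 1

instance : IsProbabilityMeasure gaussianSeq := by
  unfold gaussianSeq; infer_instance

theorem measurePreserving_comp_gaussianSeq {σ : ℕ → ℕ} (hσ : Function.Injective σ) :
    MeasurePreserving (fun h : ℕ → ℝ => fun a => h (σ a)) gaussianSeq gaussianSeq :=
  ⟨by fun_prop, Measure.map_infinitePi_infinitePi_of_inj (P := fun _ => gaussianReal 0 1) hσ⟩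

theorem hasLaw_eval_gaussianSeq (a : ℕ) :
    HasLaw (fun h : ℕ → ℝ => h a) (gaussianReal 0 1) gaussianSeq :=
  (measurePreserving_eval_infinitePi (fun _ : ℕ => gaussianReal 0 1) a).hasLaw

theorem iIndepFun_gaussianSeq (c : ℕ → ℝ) :
    iIndepFun (fun a (h : ℕ → ℝ) => c a * h a) gaussianSeq :=
  iIndepFun_infinitePi (P := fun _ : ℕ => gaussianReal 0 1) (X := fun a x => c a * x)
    (fun a => by fun_prop)

theorem hasGaussianLaw_gaussianSeq (c : ℕ → ℝ) (a : ℕ) :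
    HasGaussianLaw (fun h : ℕ → ℝ => c a * h a) gaussianSeq := by
  have : HasGaussianLaw (fun h : ℕ → ℝ => h a) gaussianSeq := by
    constructor
    rw [(hasLaw_eval_gaussianSeq a).map_eq]
    infer_instance
  exact this.map_fun (c a • ContinuousLinearMap.id ℝ ℝ)

theorem hasGaussianLaw_sum_gaussianSeq (c : ℕ → ℝ) (n : ℕ) :
    HasGaussianLaw (fun h : ℕ → ℝ => ∑ a ∈ Finset.range n, c a * h a) gaussianSeq := by
  have := iIndepFun.hasGaussianLaw_fun_sum (X := fun (a : Fin n) (h : ℕ → ℝ) => c a * h a)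
    (fun a => hasGaussianLaw_gaussianSeq c a)
    ((iIndepFun_gaussianSeq c).precomp Fin.val_injective)
  simpa [Finset.sum_range] using this

theorem variance_sum_gaussianSeq (c : ℕ → ℝ) (n : ℕ) :
    Var[fun h : ℕ → ℝ => ∑ a ∈ Finset.range n, c a * h a; gaussianSeq] =
      ∑ a ∈ Finset.range n, c a ^ 2 := by
  have e : (fun h : ℕ → ℝ => ∑ a ∈ Finset.range n, c a * h a) =
      ∑ a ∈ Finset.range n, fun h : ℕ → ℝ => c a * h a := by
    ext h; simp
  rw [e, IndepFun.variance_sum]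
  · refine Finset.sum_congr rfl fun a _ => ?_
    rw [variance_const_mul, (hasLaw_eval_gaussianSeq a).variance_eq, variance_id_gaussianReal]
    simp
  · exact fun a _ => (hasGaussianLaw_gaussianSeq c a).memLp_two
  · exact fun a _ b _ hab => (iIndepFun_gaussianSeq c).indepFun hab

theorem integral_sum_gaussianSeq (c : ℕ → ℝ) (n : ℕ) :
    ∫ h, ∑ a ∈ Finset.range n, c a * h a ∂gaussianSeq = 0 := by
  rw [integral_finsetSum _ fun a _ => (hasGaussianLaw_gaussianSeq c a).integrable]
  refine Finset.sum_eq_zero fun a _ => ?_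
  rw [integral_const_mul, (hasLaw_eval_gaussianSeq a).integral_eq, integral_id_gaussianReal,
    mul_zero]

theorem ae_sum_gaussianSeq_ne_zero {c : ℕ → ℝ} {n a : ℕ} (ha : a < n) (hc : c a ≠ 0) :
    ∀ᵐ h ∂gaussianSeq, ∑ a ∈ Finset.range n, c a * h a ≠ 0 := by
  have hm := (hasGaussianLaw_sum_gaussianSeq c n).map_eq_gaussianReal
  have hv : (Var[fun h : ℕ → ℝ => ∑ a ∈ Finset.range n, c a * h a; gaussianSeq]).toNNReal ≠ 0 := by
    rw [variance_sum_gaussianSeq]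
    have : 0 < ∑ a ∈ Finset.range n, c a ^ 2 :=
      Finset.sum_pos' (fun _ _ => sq_nonneg _) ⟨a, by simpa using ha, by positivity⟩
    simpa using this
  have := nullSingletonClass_gaussianReal
    (μ := gaussianSeq[fun h : ℕ → ℝ => ∑ a ∈ Finset.range n, c a * h a]) hv
  rw [← hm] at this
  have h0 := measure_singleton
    (μ := gaussianSeq.map fun h : ℕ → ℝ => ∑ a ∈ Finset.range n, c a * h a) (0 : ℝ)
  rw [Measure.map_apply (by fun_prop) (measurableSet_singleton _)] at h0
  rw [ae_iff]
  convert h0 using 2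
  ext h; simp

theorem walk_sub_walk (h : ℕ → ℝ) {a b n : ℕ} (hab : a ≤ b) (hb : b ≤ n) :
    walk h b - walk h a = ∑ x ∈ Finset.range n, if a ≤ x ∧ x < b then h x else 0 := by
  rw [walk, walk, ← Finset.sum_Ico_eq_sub _ hab, ← Finset.sum_filter]
  congr 1
  ext x
  simp only [Finset.mem_Ico, Finset.mem_filter, Finset.mem_range]
  omega

/-- For each pair of different chords, equality of slopes is a nontrivial linear relation between
Gaussian variables, hence a null event; there are countably many pairs. -/
theorem ae_distinctSlopes : ∀ᵐ h ∂gaussianSeq, DistinctSlopes h := by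
  unfold DistinctSlopes
  simp only [ae_all_iff]
  intro a b c d hab hcd hne
  set n := max b d
  let w : ℕ → ℝ := fun x => (if a ≤ x ∧ x < b then (d : ℝ) - c else 0) -
    (if c ≤ x ∧ x < d then (b : ℝ) - a else 0)
  have hba : (a : ℝ) < b := by exact_mod_cast hab
  have hdc : (c : ℝ) < d := by exact_mod_cast hcd
  -- Two different nonempty intervals of steps differ at some step, and there only one of the two
  -- terms of `w` survives.
  obtain ⟨x, hx, hw⟩ : ∃ x < n, w x ≠ 0 := by
    by_cases h1 : ∃ x, (a ≤ x ∧ x < b) ∧ ¬ (c ≤ x ∧ x < d)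
    · obtain ⟨x, hx, hx'⟩ := h1
      exact ⟨x, by omega, by simp only [w, if_pos hx, if_neg hx']; linarith⟩
    · obtain ⟨x, hx, hx'⟩ : ∃ x, (c ≤ x ∧ x < d) ∧ ¬ (a ≤ x ∧ x < b) := by
        by_contra h2
        push Not at h1 h2
        have := h1 a ⟨le_rfl, hab⟩
        have := h1 (b - 1) ⟨by omega, by omega⟩
        have := h2 c ⟨le_rfl, hcd⟩
        have := h2 (d - 1) ⟨by omega, by omega⟩
        exact hne (by ext <;> simp <;> omega)
      exact ⟨x, by omega, by simp only [w, if_pos hx, if_neg hx']; linarith⟩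
  filter_upwards [ae_sum_gaussianSeq_ne_zero hx hw] with h hh heq
  refine hh ?_
  rw [walk_sub_walk h hab.le (le_max_left b d), walk_sub_walk h hcd.le (le_max_right b d),
    ← sub_eq_zero, Finset.sum_mul, Finset.sum_mul, ← Finset.sum_sub_distrib] at heq
  rw [← heq]
  refine Finset.sum_congr rfl fun y _ => ?_
  simp only [w]
  split_ifs <;> ring

theorem walk_eq_sum (h : ℕ → ℝ) (m : ℕ) : walk h m = ∑ a ∈ Finset.range m, (fun _ => 1) a * h a := by
  simp [walk]

theorem measurable_walk (t : ℕ) : Measurable fun h : ℕ → ℝ => walk h t := by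
  unfold walk; fun_prop

theorem integrable_sq_walk (m : ℕ) : Integrable (fun h => walk h m ^ 2) gaussianSeq := by
  simp_rw [walk_eq_sum]
  exact (hasGaussianLaw_sum_gaussianSeq _ m).memLp_two.integrable_sq

theorem integral_sq_walk (m : ℕ) : ∫ h, walk h m ^ 2 ∂gaussianSeq = m := by
  have h1 := variance_sum_gaussianSeq (fun _ => 1) m
  rw [variance_of_integral_eq_zero (hasGaussianLaw_sum_gaussianSeq _ m).aemeasurable (integral_sum_gaussianSeq _ m)] at h1
  simp_rw [walk_eq_sum]
  rw [h1]; simp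

/-! ### Block insertion and rotation -/

/-- Reindexing that moves the first `m` entries of a sequence to the positions `i, …, i + m - 1`. -/
def insertBlock (m i a : ℕ) : ℕ := if a < i then m + a else if a < i + m then a - i else a

/-- Cyclic rotation of the first `m` entries. -/
def rotateBlock (m r a : ℕ) : ℕ := if a < m then (if a + r < m then a + r else a + r - m) else a

theorem insertBlock_injective (m i : ℕ) : Function.Injective (insertBlock m i) := by
  intro a b hab
  unfold insertBlock at hab
  split_ifs at hab <;> omega

theorem rotateBlock_injective {m r : ℕ} (hr : r < m) : Function.Injective (rotateBlock m r) := by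
  intro a b hab
  unfold rotateBlock at hab
  split_ifs at hab <;> omega

theorem walk_insertBlock_before (h : ℕ → ℝ) (m i : ℕ) {t : ℕ} (ht : t ≤ i) :
    walk (fun a => h (insertBlock m i a)) t = walk h (m + t) - walk h m := by
  induction t with
  | zero => simp [walk_zero]
  | succ t ih =>
    rw [walk_succ, ih (by omega), ← add_assoc, walk_succ, insertBlock, if_pos (by omega)]
    ring

theorem walk_insertBlock_inside (h : ℕ → ℝ) (m i : ℕ) {u : ℕ} (hu : u ≤ m) :
    walk (fun a => h (insertBlock m i a)) (i + u) =
      walk h (m + i) - walk h m + walk h u := by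
  induction u with
  | zero => simp [walk_zero, walk_insertBlock_before]
  | succ u ih =>
    rw [← add_assoc, walk_succ, ih (by omega), walk_succ, insertBlock, if_neg (by omega),
      if_pos (by omega), Nat.add_sub_cancel_left]
    ring

theorem walk_insertBlock_after (h : ℕ → ℝ) (m i u : ℕ) :
    walk (fun a => h (insertBlock m i a)) (i + m + u) = walk h (m + (i + u)) := by
  induction u with
  | zero => rw [add_zero, walk_insertBlock_inside _ _ _ le_rfl]; simp
  | succ u ih =>
    rw [← add_assoc, walk_succ, ih, insertBlock, if_neg (by omega), if_neg (by omega),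
      show m + (i + (u + 1)) = m + (i + u) + 1 by ring, walk_succ]
    congr 2
    ring

/-- The face condition splits into times inside the block and times outside. The first part does not
involve `i`; the second says that `i` minimizes the walk of the remaining steps, tilted by the slope
of the block. -/
theorem isFace_insertBlock {l m i : ℕ} (h : ℕ → ℝ) (hm : 0 < m) (hi : i + m ≤ l) :
    IsFace l (fun a => h (insertBlock m i a)) i (i + m) ↔
      (∀ u ≤ m, walk h m * u ≤ walk h u * m) ∧
      ∀ t ≤ l - m, walk h (m + i) * m - walk h m * i ≤ walk h (m + t) * m - walk h m * t := by
  have e1 := walk_insertBlock_before h m i le_rfl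
  have e2 := walk_insertBlock_inside h m i (le_refl m)
  constructor
  · rintro ⟨-, -, H⟩
    refine ⟨fun u hu => ?_, fun t ht => ?_⟩
    · have := H (i + u) (by omega)
      rw [walk_insertBlock_inside h m i hu, e1, e2] at this
      push_cast at this
      linarith
    · rcases Nat.le_total t i with hti | hti
      · have := H t (by omega)
        rw [walk_insertBlock_before h m i hti, e1, e2] at this
        push_cast at this
        linarith
      · obtain ⟨u, rfl⟩ := Nat.exists_eq_add_of_le hti
        have := H (i + m + u) (by omega)
        rw [walk_insertBlock_after h m i u, e1, e2] at this
        push_cast at this ⊢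
        linarith
  · rintro ⟨H1, H2⟩
    refine ⟨by omega, hi, fun t ht => ?_⟩
    rcases Nat.le_total t i with hti | hti
    · have := H2 t (by omega)
      rw [walk_insertBlock_before h m i hti, e1, e2]
      push_cast
      linarith
    · obtain ⟨u, rfl⟩ := Nat.exists_eq_add_of_le hti
      rcases Nat.le_total u m with hu | hu
      · have := H1 u hu
        rw [walk_insertBlock_inside h m i hu, e1, e2]
        push_cast
        linarith
      · obtain ⟨v, rfl⟩ := Nat.exists_eq_add_of_le hu
        have := H2 (i + v) (by omega)
        rw [← add_assoc, walk_insertBlock_after h m i v, e1, e2]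
        push_cast at this ⊢
        linarith

theorem walk_rotateBlock_before (h : ℕ → ℝ) (m r : ℕ) {u : ℕ} (hu : u + r ≤ m) :
    walk (fun a => h (rotateBlock m r a)) u = walk h (u + r) - walk h r := by
  induction u with
  | zero => simp [walk_zero]
  | succ u ih =>
    rw [walk_succ, ih (by omega), add_right_comm, walk_succ, rotateBlock, if_pos (by omega),
      if_pos (by omega)]
    ring

theorem walk_rotateBlock_after (h : ℕ → ℝ) {m r : ℕ} (hr : r < m) {v : ℕ} (hv : v ≤ r) :
    walk (fun a => h (rotateBlock m r a)) (m - r + v) = walk h m - walk h r + walk h v := by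
  induction v with
  | zero =>
    rw [add_zero, walk_rotateBlock_before h m r (by omega), Nat.sub_add_cancel hr.le, walk_zero,
      add_zero]
  | succ v ih =>
    rw [← add_assoc, walk_succ, ih (by omega), walk_succ, rotateBlock, if_pos (by omega),
      if_neg (by omega), show m - r + v + r - m = v by omega]
    ring

/-- The cyclic lemma: a rotation starting at `r` keeps the bridge above its chord iff `r` is a
minimum of the walk minus its chord. Times up to `m - 1` suffice, since times `0` and `m` agree on
the cycle. -/
theorem above_rotateBlock_iff {m r : ℕ} (h : ℕ → ℝ) (hr : r < m) :
    (∀ u ≤ m, walk (fun a => h (rotateBlock m r a)) m * u ≤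
        walk (fun a => h (rotateBlock m r a)) u * m) ↔
      ∀ u ≤ m - 1, walk h r * m - walk h m * r ≤ walk h u * m - walk h m * u := by
  have e : walk (fun a => h (rotateBlock m r a)) m = walk h m := by
    have := walk_rotateBlock_after h hr le_rfl
    rw [Nat.sub_add_cancel hr.le] at this
    rw [this]; ring
  have hc : ((m - r : ℕ) : ℝ) = m - r := by exact_mod_cast Nat.cast_sub hr.le
  rw [e]
  constructor
  · intro H u hu
    rcases Nat.lt_or_ge u r with hur | hur
    · have := H (m - r + u) (by omega)
      rw [walk_rotateBlock_after h hr hur.le] at this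
      push_cast [hc] at this
      linarith
    · obtain ⟨v, rfl⟩ := Nat.exists_eq_add_of_le hur
      have := H v (by omega)
      rw [walk_rotateBlock_before h m r (by omega), add_comm] at this
      push_cast
      linarith
  · intro H u hu
    rcases Nat.lt_or_ge (u + r) m with hur | hur
    · have := H (u + r) (by omega)
      rw [walk_rotateBlock_before h m r hur.le]
      push_cast at this
      linarith
    · obtain ⟨v, rfl⟩ : ∃ v, u = m - r + v := ⟨u + r - m, by omega⟩
      have := H v (by omega)
      rw [walk_rotateBlock_after h hr (by omega)]
      push_cast [hc]
      linarith

/-! ### Mean contribution of the faces of a given length -/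

open Classical in
theorem sum_ite_argmin_eq_one {n : ℕ} {f : ℕ → ℝ}
    (hf : ∀ s t, s < t → t ≤ n → f s ≠ f t) :
    ∑ i ∈ Finset.range (n + 1), (if ∀ t ≤ n, f i ≤ f t then (1 : ℝ) else 0) = 1 := by
  obtain ⟨i, hi, hmin⟩ := Finset.exists_min_image (Finset.range (n + 1)) f ⟨0, by simp⟩
  rw [Finset.sum_eq_single_of_mem i hi, if_pos]
  · exact fun t ht => hmin t (by simp; omega)
  · intro j hj hne
    rw [if_neg]
    intro H
    simp only [Finset.mem_range] at hi hj
    have h1 := H i (by omega)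
    have h2 := hmin j (by simp; omega)
    rcases Nat.lt_or_ge i j with h3 | h3
    · exact hf i j h3 (by omega) (le_antisymm h2 h1)
    · exact hf j i (by omega) (by omega) (le_antisymm h1 h2)

open Classical in
theorem DistinctSlopes.sum_argmin_insert {h : ℕ → ℝ} (hg : DistinctSlopes h) {m : ℕ} (hm : 0 < m)
    (n : ℕ) : ∑ i ∈ Finset.range (n + 1), (if ∀ t ≤ n, walk h (m + i) * m - walk h m * i ≤
      walk h (m + t) * m - walk h m * t then (1 : ℝ) else 0) = 1 := by
  refine sum_ite_argmin_eq_one (f := fun t => walk h (m + t) * m - walk h m * t)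
    fun s t hst _ heq => ?_
  refine hg (m + s) (m + t) 0 m (by omega) hm (by simp; omega) ?_
  push_cast
  rw [walk_zero]
  linarith

open Classical in
theorem DistinctSlopes.sum_argmin_rotate {h : ℕ → ℝ} (hg : DistinctSlopes h) {m : ℕ} (hm : 0 < m) :
    ∑ r ∈ Finset.range m, (if ∀ u ≤ m - 1, walk h r * m - walk h m * r ≤
      walk h u * m - walk h m * u then (1 : ℝ) else 0) = 1 := by
  obtain ⟨n, rfl⟩ : ∃ n, m = n + 1 := ⟨m - 1, by omega⟩
  refine sum_ite_argmin_eq_one (f := fun t => walk h t * ((n + 1 : ℕ) : ℝ) - walk h (n + 1) * t)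
    fun s t hst ht heq => ?_
  refine hg s t 0 (n + 1) (by omega) hm (by simp; omega) ?_
  rw [walk_zero]
  push_cast at heq ⊢
  linarith

theorem integrable_ite_of_measurableSet {Ω : Type*} [MeasurableSpace Ω] {μ : Measure Ω}
    {P : Ω → Prop} [DecidablePred P] {F : Ω → ℝ} (hF : Integrable F μ) (hP : MeasurableSet {x | P x}) :
    Integrable (fun x => if P x then F x else 0) μ := by
  refine (hF.indicator hP).congr (ae_of_all _ fun x => ?_)
  by_cases hx : P x <;> simp [hx]

theorem integral_comp_gaussianSeq {σ : ℕ → ℕ} (hσ : Function.Injective σ) {F : (ℕ → ℝ) → ℝ}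
    (hF : Measurable F) :
    ∫ h, F (fun a => h (σ a)) ∂gaussianSeq = ∫ h, F h ∂gaussianSeq := by
  have := measurePreserving_comp_gaussianSeq hσ
  conv_rhs => rw [← this.map_eq]
  rw [integral_map this.measurable.aemeasurable hF.aestronglyMeasurable]

theorem measurableSet_isFace (l i j : ℕ) : MeasurableSet {h | IsFace l h i j} := by
  have hw := measurable_walk
  simp only [IsFace, Set.ofPred_and, Set.ofPred_forall]
  refine .inter (.const _) (.inter (.const _) ?_)
  exact .iInter fun t => .iInter fun _ => measurableSet_le (by fun_prop) (by fun_prop)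

theorem measurableSet_above (m : ℕ) :
    MeasurableSet {h : ℕ → ℝ | ∀ u ≤ m, walk h m * u ≤ walk h u * m} := by
  have hw := measurable_walk
  simp only [Set.ofPred_forall]
  exact .iInter fun t => .iInter fun _ => measurableSet_le (by fun_prop) (by fun_prop)

theorem measurableSet_argmin_insert (m i n : ℕ) :
    MeasurableSet {h : ℕ → ℝ | ∀ t ≤ n, walk h (m + i) * m - walk h m * i ≤
      walk h (m + t) * m - walk h m * t} := by
  have hw := measurable_walk
  simp only [Set.ofPred_forall]
  exact .iInter fun t => .iInter fun _ => measurableSet_le (by fun_prop) (by fun_prop)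

theorem measurableSet_argmin_rotate (m r n : ℕ) :
    MeasurableSet {h : ℕ → ℝ | ∀ u ≤ n, walk h r * m - walk h m * r ≤
      walk h u * m - walk h m * u} := by
  have hw := measurable_walk
  simp only [Set.ofPred_forall]
  exact .iInter fun t => .iInter fun _ => measurableSet_le (by fun_prop) (by fun_prop)

open Classical in
theorem measurable_faceTerm (l i j : ℕ) : Measurable fun h : ℕ → ℝ =>
    if IsFace l h i j then (walk h j - walk h i) ^ 2 else 0 := by
  have hw := measurable_walk
  exact Measurable.ite (measurableSet_isFace l i j) (by fun_prop) measurable_const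

open Classical in
theorem measurable_aboveTerm (m : ℕ) : Measurable fun h : ℕ → ℝ =>
    if ∀ u ≤ m, walk h m * u ≤ walk h u * m then walk h m ^ 2 else 0 := by
  have hw := measurable_walk
  exact Measurable.ite (measurableSet_above m) (by fun_prop) measurable_const

-- Each rotation preserves the law and the value of `walk h m`, and almost surely exactly one
-- rotation lies above its chord. So `m` copies of the integral add up to the second moment `m`.
open Classical in
theorem integral_aboveTerm {m : ℕ} (hm : 0 < m) :
    ∫ h, (if ∀ u ≤ m, walk h m * u ≤ walk h u * m then walk h m ^ 2 else 0) ∂gaussianSeq = 1 := by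
  set I := ∫ h, (if ∀ u ≤ m, walk h m * u ≤ walk h u * m then walk h m ^ 2 else 0) ∂gaussianSeq
    with hI
  have h1 : ∀ r ∈ Finset.range m, I = ∫ h, (if ∀ u ≤ m - 1, walk h r * m - walk h m * r ≤
      walk h u * m - walk h m * u then walk h m ^ 2 else 0) ∂gaussianSeq := by
    intro r hr
    rw [Finset.mem_range] at hr
    rw [hI, ← integral_comp_gaussianSeq (rotateBlock_injective hr) (measurable_aboveTerm m)]
    refine integral_congr_ae (ae_of_all _ fun h => ?_)
    simp only [above_rotateBlock_iff h hr]
    have := walk_rotateBlock_after h hr le_rfl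
    rw [Nat.sub_add_cancel hr.le] at this
    rw [this, sub_add_cancel]
  have h2 : (m : ℝ) * I = m := by
    have : ∑ r ∈ Finset.range m, I = m * I := by simp
    rw [← this, Finset.sum_congr rfl h1, ← integral_finsetSum]
    · refine Eq.trans ?_ (integral_sq_walk m)
      refine integral_congr_ae ?_
      filter_upwards [ae_distinctSlopes] with h hg
      have := congrArg (walk h m ^ 2 * ·) (hg.sum_argmin_rotate hm)
      simpa only [mul_one, Finset.mul_sum, mul_ite, mul_zero] using this
    · exact fun r _ => integrable_ite_of_measurableSet (integrable_sq_walk m)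
        (measurableSet_argmin_rotate m r (m - 1))
  have : (m : ℝ) ≠ 0 := by positivity
  exact mul_left_cancel₀ this (by rw [h2, mul_one])

open Classical in
theorem integrable_faceTerm (l i j : ℕ) : Integrable (fun h : ℕ → ℝ =>
    if IsFace l h i j then (walk h j - walk h i) ^ 2 else 0) gaussianSeq := by
  refine integrable_ite_of_measurableSet ?_ (measurableSet_isFace l i j)
  have hL (t : ℕ) : MemLp (fun h => walk h t) 2 gaussianSeq := by
    rw [memLp_two_iff_integrable_sq (measurable_walk t).aestronglyMeasurable]
    exact integrable_sq_walk t
  exact ((hL j).sub (hL i)).integrable_sq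

-- After the block is moved to the front, the conditions for different `i` differ only in the
-- insertion point, and almost surely exactly one insertion point works. What is left is the mean of
-- the block factor, `integral_aboveTerm`.
open Classical in
theorem sum_integral_faceTerm {l m : ℕ} (hm : 0 < m) (hl : m ≤ l) :
    ∑ i ∈ Finset.range (l - m + 1), ∫ h, (if IsFace l h i (i + m) then
      (walk h (i + m) - walk h i) ^ 2 else 0) ∂gaussianSeq = 1 := by
  have h1 : ∀ i ∈ Finset.range (l - m + 1), ∫ h, (if IsFace l h i (i + m) then
      (walk h (i + m) - walk h i) ^ 2 else 0) ∂gaussianSeq =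
      ∫ h, (if ∀ t ≤ l - m, walk h (m + i) * m - walk h m * i ≤
      walk h (m + t) * m - walk h m * t then
        (if ∀ u ≤ m, walk h m * u ≤ walk h u * m then walk h m ^ 2 else 0) else 0)
        ∂gaussianSeq := by
    intro i hi
    rw [Finset.mem_range] at hi
    rw [← integral_comp_gaussianSeq (insertBlock_injective m i) (measurable_faceTerm l i (i + m))]
    refine integral_congr_ae (ae_of_all _ fun h => ?_)
    simp only [isFace_insertBlock h hm (show i + m ≤ l by omega)]
    rw [walk_insertBlock_inside h m i le_rfl, walk_insertBlock_before h m i le_rfl,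
      add_sub_cancel_left]
    simp only [← ite_and, and_comm]
  rw [Finset.sum_congr rfl h1, ← integral_finsetSum]
  · rw [← integral_aboveTerm hm]
    refine integral_congr_ae ?_
    filter_upwards [ae_distinctSlopes] with h hg
    have := congrArg ((if ∀ u ≤ m, walk h m * u ≤ walk h u * m then walk h m ^ 2 else 0) * ·)
      (hg.sum_argmin_insert hm (l - m))
    simpa only [mul_one, Finset.mul_sum, mul_ite, mul_zero] using this
  · exact fun i _ => integrable_ite_of_measurableSet
      (integrable_ite_of_measurableSet (integrable_sq_walk m) (measurableSet_above m))
      (measurableSet_argmin_insert m i (l - m))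

theorem measurable_faceSum (l : ℕ) : Measurable (faceSum l) := by
  classical
  unfold faceSum
  refine Finset.measurable_sum _ fun m _ => Finset.measurable_sum _ fun i _ => ?_
  have hw := measurable_walk
  exact Measurable.ite (measurableSet_isFace l i _) (by fun_prop) measurable_const

theorem faceSum_eq (l : ℕ) : faceSum l = fun h => open Classical in
    ∑ m ∈ Finset.range l, (∑ i ∈ Finset.range (l - m), if IsFace l h i (i + (m + 1)) then
      (walk h (i + (m + 1)) - walk h i) ^ 2 else 0) / ((m : ℝ) + 1) := by
  ext h
  simp only [faceSum, Finset.sum_div, ite_div, zero_div]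

theorem integrable_faceSum (l : ℕ) : Integrable (faceSum l) gaussianSeq := by
  rw [faceSum_eq]
  exact integrable_finsetSum _ fun m _ => (integrable_finsetSum _ fun i _ =>
    integrable_faceTerm l i _).div_const _

/-- The mean of the squared norm of the isotonic regression of `l` standard Gaussian variables is
the harmonic number. -/
theorem integral_faceSum (l : ℕ) :
    ∫ h, faceSum l h ∂gaussianSeq = ∑ m ∈ Finset.range l, 1 / ((m : ℝ) + 1) := by
  rw [faceSum_eq, integral_finsetSum _ fun m _ => (integrable_finsetSum _ fun i _ =>
    integrable_faceTerm l i _).div_const _]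
  refine Finset.sum_congr rfl fun m hm => ?_
  rw [Finset.mem_range] at hm
  rw [integral_div, integral_finsetSum _ fun i _ => integrable_faceTerm l i _]
  rw [show l - m = l - (m + 1) + 1 by omega, sum_integral_faceTerm (by omega) (by omega)]

/-! ### Splitting a cycle into blocks -/

section Blocks

variable {V : Type*} [AddCommGroup V] (c : ℕ →+ V) (S : Finset V)

/-- The number of steps from `s` to the next element of `S`. -/
def blockLength (s : V) : ℕ := sInf {l | 1 ≤ l ∧ s + c l ∈ S}

/-- The number of steps back from `y` to the previous element of `S`. -/
def blockOffset (y : V) : ℕ := sInf {t | y - c t ∈ S}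

variable {c S}

/-- The period `n` leads back to `s`, so the infimum is over a nonempty set and the default value
`0` of `sInf` plays no role. -/
theorem lt_blockLength_iff {s : V} {n t : ℕ} (hs : s ∈ S) (hn : 0 < n) (hc : c n = 0) :
    t < blockLength c S s ↔ ∀ u, 1 ≤ u → u ≤ t → s + c u ∉ S := by
  have hne : {l | 1 ≤ l ∧ s + c l ∈ S}.Nonempty := ⟨n, hn, by simpa [hc] using hs⟩
  constructor
  · intro h u h1 h2 h3
    have : blockLength c S s ≤ u := Nat.sInf_le ⟨h1, h3⟩
    omega
  · intro h
    have := Nat.sInf_mem hne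
    by_contra hlt
    exact h _ this.1 (by simpa [blockLength] using hlt) this.2

theorem sub_blockOffset_mem {y : V} (hy : ∃ t, y - c t ∈ S) : y - c (blockOffset c S y) ∈ S :=
  Nat.sInf_mem hy

theorem blockOffset_lt {y : V} {n : ℕ} (hn : 0 < n) (hc : c n = 0) (hy : ∃ t, y - c t ∈ S) :
    blockOffset c S y < blockLength c S (y - c (blockOffset c S y)) := by
  rw [lt_blockLength_iff (sub_blockOffset_mem hy) hn hc]
  intro u h1 h2 h3
  have e : y - c (blockOffset c S y) + c u = y - c (blockOffset c S y - u) := by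
    conv_lhs => rw [← Nat.sub_add_cancel h2, map_add]
    abel
  rw [e] at h3
  have : blockOffset c S y ≤ blockOffset c S y - u := Nat.sInf_le h3
  omega

theorem blockOffset_add {s : V} {n t : ℕ} (hs : s ∈ S) (hn : 0 < n) (hc : c n = 0)
    (ht : t < blockLength c S s) : blockOffset c S (s + c t) = t := by
  have hmem : s + c t - c t ∈ S := by simpa using hs
  have hle : blockOffset c S (s + c t) ≤ t := Nat.sInf_le hmem
  by_contra hne
  have h1 := sub_blockOffset_mem (c := c) (S := S) ⟨t, hmem⟩
  have e : s + c t - c (blockOffset c S (s + c t)) = s + c (t - blockOffset c S (s + c t)) := by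
    conv_lhs => lhs; rw [← Nat.sub_add_cancel hle, map_add]
    abel
  rw [e] at h1
  exact (lt_blockLength_iff hs hn hc).1 ht _ (by omega) (by omega) h1

/-- Each point is determined by the last element of `S` at or before it and the offset from there,
which is smaller than the length of that block. -/
theorem sum_eq_sum_blocks [Fintype V] {n : ℕ} (hn : 0 < n) (hc : c n = 0)
    (hS : ∀ y, ∃ t, y - c t ∈ S) (F : V → ℝ) :
    ∑ y, F y = ∑ s ∈ S, ∑ t ∈ Finset.range (blockLength c S s), F (s + c t) := by
  rw [Finset.sum_sigma']
  symm
  refine Finset.sum_bij' (fun p _ => p.1 + c p.2)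
    (fun y _ => ⟨y - c (blockOffset c S y), blockOffset c S y⟩) ?_ ?_ ?_ ?_ ?_
  · simp
  · intro y _
    simpa using ⟨sub_blockOffset_mem (hS y), blockOffset_lt hn hc (hS y)⟩
  · rintro ⟨s, t⟩ hp
    simp only [Finset.mem_sigma, Finset.mem_range] at hp
    simp [blockOffset_add hp.1 hn hc hp.2]
  · simp
  · simp

end Blocks

/-! ### The descent cone as a monotone cone on the cycle -/

/-- The number of a step modulo `M + 1`. -/
def cyclicStep (M : ℕ) : ℕ →+ Fin (M + 1) where
  toFun t := Fin.ofNat (M + 1) t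
  map_zero' := by ext; simp
  map_add' a b := by ext; simp [Fin.val_add]

theorem cyclicStep_one (M : ℕ) : cyclicStep M 1 = 1 := by
  ext; simp [cyclicStep]

theorem cyclicStep_period (M : ℕ) : cyclicStep M (M + 1) = 0 := by
  ext; simp [cyclicStep]

theorem cyclicStep_val {M : ℕ} (i : Fin (M + 1)) : cyclicStep M i = i := by
  ext; simp [cyclicStep]

theorem cyclicStep_injOn {M a b : ℕ} (ha : a < M + 1) (hb : b < M + 1)
    (h : cyclicStep M a = cyclicStep M b) : a = b := by
  simpa [cyclicStep, Fin.ext_iff, Nat.mod_eq_of_lt ha, Nat.mod_eq_of_lt hb] using h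

theorem exists_sub_cyclicStep_mem {M : ℕ} {S : Finset (Fin (M + 1))} (hS : S.Nonempty)
    (y : Fin (M + 1)) : ∃ t, y - cyclicStep M t ∈ S := by
  obtain ⟨s, hs⟩ := hS
  refine ⟨(y - s : Fin (M + 1)), ?_⟩
  rw [cyclicStep_val]
  simpa using hs

theorem blockLength_le {M : ℕ} {S : Finset (Fin (M + 1))} {s : Fin (M + 1)} (hs : s ∈ S) :
    blockLength (cyclicStep M) S s ≤ M + 1 :=
  Nat.sInf_le ⟨by omega, by simpa [cyclicStep_period] using hs⟩

/-- The signals that increase at every position of the cycle outside `S`. -/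
def cyclicCone {M : ℕ} (S : Finset (Fin (M + 1))) : Set (EuclideanSpace ℝ (Fin (M + 1))) :=
  {y | ∀ i ∉ S, y (i - 1) ≤ y i}

theorem isClosed_cyclicCone {M : ℕ} (S : Finset (Fin (M + 1))) : IsClosed (cyclicCone S) := by
  simp only [cyclicCone, Set.ofPred_forall]
  exact isClosed_iInter fun i => isClosed_iInter fun _ => isClosed_le (by fun_prop) (by fun_prop)

theorem convex_cyclicCone {M : ℕ} (S : Finset (Fin (M + 1))) : Convex ℝ (cyclicCone S) := by
  intro y hy z hz a b ha hb _ i hi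
  simp only [PiLp.add_apply, PiLp.smul_apply, smul_eq_mul]
  exact add_le_add (mul_le_mul_of_nonneg_left (hy i hi) ha)
    (mul_le_mul_of_nonneg_left (hz i hi) hb)

theorem nonempty_cyclicCone {M : ℕ} (S : Finset (Fin (M + 1))) : (cyclicCone S).Nonempty :=
  ⟨0, fun i _ => by simp⟩

theorem monotoneTV_le_iff {M : ℕ} {x z : EuclideanSpace ℝ (Fin (M + 1))}
    (hx : Monotone fun i => x i) : monotoneTV (M + 1) z ≤ monotoneTV (M + 1) x ↔
      Monotone (fun i => z i) ∧ z (Fin.last M) - z 0 ≤ x (Fin.last M) - x 0 := by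
  simp only [monotoneTV, if_pos hx]
  split_ifs with h
  · rw [EReal.coe_le_coe_iff]
    simp [h]
  · simp only [h, false_and, iff_false, top_le_iff]
    exact EReal.coe_ne_top _

theorem succ_sub_one_eq {M : ℕ} (i : Fin M) : i.succ - 1 = i.castSucc := by
  rw [sub_eq_iff_eq_add, Fin.coeSucc_eq_succ]

theorem zero_sub_one_eq (M : ℕ) : (0 : Fin (M + 1)) - 1 = Fin.last M := by
  rw [sub_eq_iff_eq_add, Fin.last_add_one]

theorem succ_mem_changePoints_iff {M : ℕ} (x : EuclideanSpace ℝ (Fin (M + 1))) (i : Fin M) :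
    i.succ ∈ changePoints x ↔ x i.castSucc < x i.succ := by
  simp only [changePoints, Finset.mem_filter, Finset.mem_univ, true_and]
  constructor
  · rintro ⟨j, hj, h⟩
    have : j = i.castSucc := by ext; simpa using hj
    rwa [← this]
  · exact fun h => ⟨i.castSucc, by simp, h⟩

theorem zero_notMem_changePoints {M : ℕ} (x : EuclideanSpace ℝ (Fin (M + 1))) :
    (0 : Fin (M + 1)) ∉ changePoints x := by
  simp [changePoints]

/-- Off the change points `x` is locally constant, so `y` must be nondecreasing there; at a change
point a small `τ` makes any `y` admissible. The bound on the total rise is the cone inequality at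
`0`, whose cyclic predecessor is the last position. -/
theorem descentCone_monotoneTV_eq {M : ℕ} {x : EuclideanSpace ℝ (Fin (M + 1))}
    (hx : Monotone fun i => x i) :
    descentCone (monotoneTV (M + 1)) x = cyclicCone (changePoints x) := by
  ext y
  simp only [descentCone, Set.mem_iUnion, Set.mem_Ioi, Set.mem_ofPred_eq, exists_prop,
    monotoneTV_le_iff hx, cyclicCone]
  constructor
  · rintro ⟨τ, hτ, hm, hl⟩ i hi
    refine le_of_mul_le_mul_left ?_ hτ
    induction i using Fin.cases with
    | zero =>
      rw [zero_sub_one_eq]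
      simp only [PiLp.add_apply, PiLp.smul_apply, smul_eq_mul] at hl
      linarith
    | succ i =>
      rw [succ_sub_one_eq]
      rw [succ_mem_changePoints_iff, not_lt] at hi
      have := hm (Fin.castSucc_lt_succ (i := i)).le
      simp only [PiLp.add_apply, PiLp.smul_apply, smul_eq_mul] at this
      linarith
  · intro hy
    have hlast := hy 0 (zero_notMem_changePoints x)
    rw [zero_sub_one_eq] at hlast
    -- One `τ` serves all change points, because there are finitely many.
    have hev : ∀ᶠ τ in 𝓝[>] (0 : ℝ), ∀ i : Fin M, x i.castSucc < x i.succ →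
        τ * (y i.castSucc - y i.succ) < x i.succ - x i.castSucc := by
      rw [eventually_all]
      intro i
      by_cases hlt : x i.castSucc < x i.succ
      · have : Tendsto (fun τ : ℝ => τ * (y i.castSucc - y i.succ)) (𝓝[>] 0) (𝓝 0) := by
          have : Continuous fun τ : ℝ => τ * (y i.castSucc - y i.succ) := by fun_prop
          simpa using (this.tendsto 0).mono_left nhdsWithin_le_nhds
        filter_upwards [this.eventually_lt_const (sub_pos.2 hlt)] with τ h _ using h
      · exact Eventually.of_forall fun τ h => absurd h hlt
    obtain ⟨τ, h, hτ⟩ := (hev.and self_mem_nhdsWithin).exists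
    refine ⟨τ, hτ, ?_, ?_⟩
    · rw [Fin.monotone_iff_le_succ]
      intro i
      simp only [PiLp.add_apply, PiLp.smul_apply, smul_eq_mul]
      by_cases hlt : x i.castSucc < x i.succ
      · linarith [h i hlt]
      · have h1 := hx (Fin.castSucc_lt_succ (i := i)).le
        have h2 := hy i.succ (by rwa [succ_mem_changePoints_iff])
        rw [succ_sub_one_eq] at h2
        simp only at h1
        linarith [mul_le_mul_of_nonneg_left h2 hτ.le]
    · simp only [PiLp.add_apply, PiLp.smul_apply, smul_eq_mul]
      linarith [mul_le_mul_of_nonneg_left hlast hτ.le]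

/-! ### Projection onto the cyclic cone -/

theorem isNearestPoint_of_inner {E : Type*} [NormedAddCommGroup E] [InnerProductSpace ℝ E]
    {C : Set E} {g p : E} (hp : p ∈ C) (h0 : inner ℝ (g - p) p = 0)
    (hC : ∀ q ∈ C, inner ℝ (g - p) q ≤ 0) : IsNearestPoint C g p := by
  refine ⟨hp, fun q hq => ?_⟩
  have h1 := hC q hq
  have e : ‖g - q‖ ^ 2 = ‖g - p‖ ^ 2 + 2 * inner ℝ (g - p) (p - q) + ‖p - q‖ ^ 2 := by
    rw [← norm_add_sq_real]; congr 2; abel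
  rw [inner_sub_right, h0] at e
  have : ‖g - p‖ ^ 2 ≤ ‖g - q‖ ^ 2 := by nlinarith [sq_nonneg ‖p - q‖]
  exact le_of_sq_le_sq this (norm_nonneg _)

/-- Blockwise isotonic regression. -/
def blockRegression {M : ℕ} (S : Finset (Fin (M + 1))) (H : Fin (M + 1) → ℕ → ℝ) :
    EuclideanSpace ℝ (Fin (M + 1)) :=
  WithLp.toLp 2 fun y =>
    minorantSlope (blockLength (cyclicStep M) S (y - cyclicStep M (blockOffset (cyclicStep M) S y)))
      (H (y - cyclicStep M (blockOffset (cyclicStep M) S y))) (blockOffset (cyclicStep M) S y)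

theorem blockRegression_apply {M : ℕ} {S : Finset (Fin (M + 1))} {H : Fin (M + 1) → ℕ → ℝ}
    {s : Fin (M + 1)} {t : ℕ} (hs : s ∈ S) (ht : t < blockLength (cyclicStep M) S s) :
    blockRegression S H (s + cyclicStep M t) =
      minorantSlope (blockLength (cyclicStep M) S s) (H s) t := by
  simp only [blockRegression, blockOffset_add hs M.succ_pos (cyclicStep_period M) ht,
    add_sub_cancel_right]

theorem blockRegression_mem {M : ℕ} {S : Finset (Fin (M + 1))} (hS : S.Nonempty)
    (H : Fin (M + 1) → ℕ → ℝ) : blockRegression S H ∈ cyclicCone S := by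
  intro i hi
  have h1 := sub_blockOffset_mem (exists_sub_cyclicStep_mem hS i)
  have h2 := blockOffset_lt M.succ_pos (cyclicStep_period M) (exists_sub_cyclicStep_mem hS i)
  obtain ⟨s, hs⟩ : ∃ s, s = i - cyclicStep M (blockOffset (cyclicStep M) S i) := ⟨_, rfl⟩
  obtain ⟨t, ht⟩ : ∃ t, t = blockOffset (cyclicStep M) S i := ⟨_, rfl⟩
  rw [← ht] at hs h1 h2
  rw [← hs] at h1 h2
  have ei : i = s + cyclicStep M t := by rw [hs]; abel
  rcases t with _ | t
  -- Offset `0` would make `i` an element of `S`; hence `i - 1` lies in the same block as `i`.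
  · rw [ei] at hi; simp [h1] at hi
  have ei' : i - 1 = s + cyclicStep M t := by
    rw [ei, map_add, cyclicStep_one]; abel
  rw [ei', ei, blockRegression_apply h1 (by omega), blockRegression_apply h1 h2]
  exact minorantSlope_mono (by omega) h2

theorem cyclicCone_step {M : ℕ} {S : Finset (Fin (M + 1))} {q : EuclideanSpace ℝ (Fin (M + 1))}
    (hq : q ∈ cyclicCone S) {s : Fin (M + 1)} {t : ℕ} (hs : s ∈ S)
    (ht : t + 1 < blockLength (cyclicStep M) S s) :
    q (s + cyclicStep M t) ≤ q (s + cyclicStep M (t + 1)) := by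
  have h1 := (lt_blockLength_iff hs M.succ_pos (cyclicStep_period M)).1 ht (t + 1) (by omega) le_rfl
  have := hq _ h1
  convert this using 2
  rw [map_add, cyclicStep_one]; abel

/-- Inner products split over the blocks, so polarity and orthogonality of the minorant slopes on
each block give both optimality conditions. -/
theorem isNearestPoint_blockRegression {M : ℕ} {S : Finset (Fin (M + 1))} (hS : S.Nonempty)
    {g : EuclideanSpace ℝ (Fin (M + 1))} {H : Fin (M + 1) → ℕ → ℝ}
    (hH : ∀ s ∈ S, ∀ t < blockLength (cyclicStep M) S s, H s t = g (s + cyclicStep M t)) :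
    IsNearestPoint (cyclicCone S) g (blockRegression S H) ∧
      inner ℝ (g - blockRegression S H) (blockRegression S H) = 0 := by
  have key (q : EuclideanSpace ℝ (Fin (M + 1))) : inner ℝ (g - blockRegression S H) q =
      ∑ s ∈ S, ∑ t ∈ Finset.range (blockLength (cyclicStep M) S s),
        (H s t - minorantSlope (blockLength (cyclicStep M) S s) (H s) t) *
          q (s + cyclicStep M t) := by
    rw [PiLp.inner_apply, sum_eq_sum_blocks M.succ_pos (cyclicStep_period M)
      (exists_sub_cyclicStep_mem hS)]
    refine Finset.sum_congr rfl fun s hs => Finset.sum_congr rfl fun t ht => ?_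
    rw [Finset.mem_range] at ht
    rw [PiLp.sub_apply, blockRegression_apply hs ht, hH s hs t ht]
    simp [mul_comm]
  have h0 : inner ℝ (g - blockRegression S H) (blockRegression S H) = 0 := by
    rw [key]
    refine Finset.sum_eq_zero fun s hs => ?_
    rw [← minorantSlope_orthogonal (blockLength (cyclicStep M) S s) (H s)]
    refine Finset.sum_congr rfl fun t ht => ?_
    rw [blockRegression_apply hs (Finset.mem_range.1 ht)]
  refine ⟨isNearestPoint_of_inner (blockRegression_mem hS H) h0 fun q hq => ?_, h0⟩
  rw [key]
  refine Finset.sum_nonpos fun s hs => ?_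
  exact minorantSlope_polar _ (H s) (fun t => q (s + cyclicStep M t))
    fun t ht => cyclicCone_step hq hs ht

theorem metricProj_cyclicCone {M : ℕ} {S : Finset (Fin (M + 1))} (hS : S.Nonempty)
    {g : EuclideanSpace ℝ (Fin (M + 1))} {H : Fin (M + 1) → ℕ → ℝ}
    (hH : ∀ s ∈ S, ∀ t < blockLength (cyclicStep M) S s, H s t = g (s + cyclicStep M t)) :
    metricProj (cyclicCone S) g = blockRegression S H :=
  ((isNearestPoint_iff_eq_metricProj (nonempty_cyclicCone S) (isClosed_cyclicCone S)
    (convex_cyclicCone S) g _).1 (isNearestPoint_blockRegression hS hH).1).symm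

theorem norm_sq_metricProj_cyclicCone {M : ℕ} {S : Finset (Fin (M + 1))} (hS : S.Nonempty)
    {g : EuclideanSpace ℝ (Fin (M + 1))} {H : Fin (M + 1) → ℕ → ℝ}
    (hH : ∀ s ∈ S, ∀ t < blockLength (cyclicStep M) S s, H s t = g (s + cyclicStep M t)) :
    ‖metricProj (cyclicCone S) g‖ ^ 2 =
      ∑ s ∈ S, ∑ t ∈ Finset.range (blockLength (cyclicStep M) S s),
        minorantSlope (blockLength (cyclicStep M) S s) (H s) t ^ 2 := by
  rw [metricProj_cyclicCone hS hH, EuclideanSpace.real_norm_sq_eq,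
    sum_eq_sum_blocks M.succ_pos (cyclicStep_period M) (exists_sub_cyclicStep_mem hS)]
  refine Finset.sum_congr rfl fun s hs => Finset.sum_congr rfl fun t ht => ?_
  rw [blockRegression_apply hs (Finset.mem_range.1 ht)]

/-- By orthogonality the quantity equals `‖g‖ ^ 2` minus the squared distance to the cone.
Continuity supplies the measurability needed to change variables in `statDim`. -/
theorem continuous_norm_sq_metricProj_cyclicCone {M : ℕ} {S : Finset (Fin (M + 1))}
    (hS : S.Nonempty) : Continuous fun g => ‖metricProj (cyclicCone S) g‖ ^ 2 := by
  have e : (fun g => ‖metricProj (cyclicCone S) g‖ ^ 2) =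
      fun g => ‖g‖ ^ 2 - Metric.infDist g (cyclicCone S) ^ 2 := by
    ext g
    obtain ⟨hp, h0⟩ := isNearestPoint_blockRegression hS (g := g)
      (H := fun s t => g (s + cyclicStep M t)) fun _ _ _ _ => rfl
    rw [metricProj_cyclicCone hS (g := g) (H := fun s t => g (s + cyclicStep M t))
      fun _ _ _ _ => rfl]
    set p := blockRegression S fun s t => g (s + cyclicStep M t)
    have hd : Metric.infDist g (cyclicCone S) = ‖g - p‖ := by
      refine le_antisymm ?_ ?_
      · rw [← dist_eq_norm]; exact Metric.infDist_le_dist_of_mem hp.1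
      · rw [Metric.le_infDist (nonempty_cyclicCone S)]
        intro q hq
        rw [dist_eq_norm]; exact hp.2 q hq
    have : ‖g‖ ^ 2 = ‖g - p‖ ^ 2 + 2 * inner ℝ (g - p) p + ‖p‖ ^ 2 := by
      rw [← norm_add_sq_real, sub_add_cancel]
    rw [hd, this, h0]; ring
  rw [e]
  have := Metric.continuous_infDist_pt (cyclicCone S)
  fun_prop

/-! ### Statistical dimension as a sum of harmonic numbers -/

theorem measurable_toLp_prefix (n : ℕ) :
    Measurable fun h : ℕ → ℝ => (WithLp.toLp 2 fun i : Fin n => h i : EuclideanSpace ℝ (Fin n)) :=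
  (WithLp.measurable_toLp 2 _).comp (by fun_prop)

theorem stdGaussian_eq_map_gaussianSeq (n : ℕ) : stdGaussian (EuclideanSpace ℝ (Fin n)) =
    gaussianSeq.map fun h => WithLp.toLp 2 fun i : Fin n => h i := by
  have h1 := Measure.map_infinitePi_infinitePi_of_inj (P := fun _ : ℕ => gaussianReal 0 1)
    (f := fun i : Fin n => (i : ℕ)) Fin.val_injective
  rw [Measure.infinitePi_eq_pi (μ := fun _ : Fin n => gaussianReal 0 1)] at h1
  rw [← map_pi_eq_stdGaussian, ← h1, Measure.map_map (by fun_prop) (by fun_prop)]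
  rfl

/-- Positions of the cycle from `s` on, continued injectively to all natural numbers. -/
def cyclicIndex {M : ℕ} (s : Fin (M + 1)) (t : ℕ) : ℕ :=
  if t < M + 1 then ((s + cyclicStep M t : Fin (M + 1)) : ℕ) else t

theorem cyclicIndex_injective {M : ℕ} (s : Fin (M + 1)) : Function.Injective (cyclicIndex s) := by
  intro a b hab
  unfold cyclicIndex at hab
  have ha := (s + cyclicStep M a).isLt
  have hb := (s + cyclicStep M b).isLt
  split_ifs at hab with h1 h2 h2
  · exact cyclicStep_injOn h1 h2 (add_left_cancel (Fin.ext hab))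
  · omega
  · omega
  · exact hab

/-- Read from any `s`, the Gaussian data again form a sequence with law `gaussianSeq`, since
`cyclicIndex s` is injective. Linearity of the integral then suffices; independence of different
blocks does not enter. -/
theorem statDim_cyclicCone {M : ℕ} {S : Finset (Fin (M + 1))} (hS : S.Nonempty) :
    statDim (cyclicCone S) = ∑ s ∈ S,
      ∑ j ∈ Finset.range (blockLength (cyclicStep M) S s), 1 / ((j : ℝ) + 1) := by
  rw [statDim, stdGaussian_eq_map_gaussianSeq, integral_map (measurable_toLp_prefix _).aemeasurable
    (continuous_norm_sq_metricProj_cyclicCone hS).aestronglyMeasurable]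
  have hae : ∀ᵐ h ∂gaussianSeq, ∀ s : Fin (M + 1),
      DistinctSlopes fun t => h (cyclicIndex s t) := by
    rw [ae_all_iff]
    exact fun s => (measurePreserving_comp_gaussianSeq
      (cyclicIndex_injective s)).quasiMeasurePreserving.ae ae_distinctSlopes
  have hint (s : Fin (M + 1)) (l : ℕ) :
      Integrable (fun h => faceSum l fun t => h (cyclicIndex s t)) gaussianSeq :=
    (measurePreserving_comp_gaussianSeq (cyclicIndex_injective s)).integrable_comp_of_integrable
      (integrable_faceSum l)
  calc _ = ∫ h, ∑ s ∈ S, faceSum (blockLength (cyclicStep M) S s)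
        (fun t => h (cyclicIndex s t)) ∂gaussianSeq := by
        refine integral_congr_ae ?_
        filter_upwards [hae] with h hg
        rw [norm_sq_metricProj_cyclicCone hS (H := fun s t => h (cyclicIndex s t))]
        · exact Finset.sum_congr rfl fun s _ => (hg s).sum_sq_minorantSlope
        · intro s hs t ht
          simp only [cyclicIndex]
          rw [if_pos (lt_of_lt_of_le ht (blockLength_le hs))]
    _ = _ := by
        rw [integral_finsetSum _ fun s _ => hint s _]
        refine Finset.sum_congr rfl fun s _ => ?_
        rw [integral_comp_gaussianSeq (cyclicIndex_injective s) (measurable_faceSum _),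
          integral_faceSum]

open Classical in
theorem statDim_cyclicCone_eq_sum {M : ℕ} {S : Finset (Fin (M + 1))} (hS : S.Nonempty) :
    statDim (cyclicCone S) = ∑ j ∈ Finset.range (M + 1), ((S.filter fun s =>
      ∀ u, 1 ≤ u → u ≤ j → s + cyclicStep M u ∉ S).card : ℝ) / ((j : ℝ) + 1) := by
  rw [statDim_cyclicCone hS]
  simp only [Finset.card_filter, Nat.cast_sum, Finset.sum_div]
  rw [Finset.sum_comm]
  refine Finset.sum_congr rfl fun s hs => ?_
  simp only [← lt_blockLength_iff hs M.succ_pos (cyclicStep_period M)]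
  have : Finset.range (blockLength (cyclicStep M) S s) =
      (Finset.range (M + 1)).filter fun j => j < blockLength (cyclicStep M) S s := by
    ext j
    have := blockLength_le hs
    simp only [Finset.mem_range, Finset.mem_filter]; omega
  rw [this, Finset.sum_filter]
  refine Finset.sum_congr rfl fun j _ => ?_
  split_ifs <;> simp

/-! ### Counting long blocks -/

open Classical in
/-- The number of `s ∈ S` such that none of the `j` cyclic successors of `s` belongs to `S`. -/
def longBlockCount {M : ℕ} (S : Finset (Fin (M + 1))) (j : ℕ) : ℕ :=
  (S.filter fun s => ∀ u, 1 ≤ u → u ≤ j → s + cyclicStep M u ∉ S).card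

/-- The windows of `j + 1` consecutive positions that start at the counted elements are disjoint.
This bound provides the domination in the limit. -/
theorem longBlockCount_mul_le {M : ℕ} (S : Finset (Fin (M + 1))) (j : ℕ) :
    longBlockCount S j * (j + 1) ≤ M + 1 := by
  classical
  rw [longBlockCount, ← Finset.card_range (j + 1), ← Finset.card_product]
  conv_rhs => rw [← Fintype.card_fin (M + 1), ← Finset.card_univ]
  refine Finset.card_le_card_of_injOn (fun p => p.1 + cyclicStep M p.2) (by simp) ?_
  have key : ∀ (s s' : Fin (M + 1)) (t t' : ℕ), s ∈ S → t' ≤ j → t < t' →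
      (∀ u, 1 ≤ u → u ≤ j → s' + cyclicStep M u ∉ S) →
      s + cyclicStep M t ≠ s' + cyclicStep M t' := by
    intro s s' t t' hs hj htt h e
    refine h (t' - t) (by omega) (by omega) ?_
    have : s' + cyclicStep M (t' - t) = s := by
      rw [← Nat.sub_add_cancel htt.le, map_add, ← add_assoc] at e
      exact (add_right_cancel e).symm
    rwa [this]
  rintro ⟨s, t⟩ h ⟨s', t'⟩ h' e
  simp only [Finset.coe_product, Set.mem_prod, Finset.mem_coe, Finset.mem_filter,
    Finset.mem_range] at h h' e
  rcases lt_trichotomy t t' with htt | rfl | htt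
  · exact absurd e (key s s' t t' h.1.1 (by omega) htt h'.1.2)
  · rw [add_right_cancel e]
  · exact absurd e.symm (key s' s t' t h'.1.1 (by omega) htt h.1.2)

theorem longBlockCount_eq_zero {M : ℕ} (S : Finset (Fin (M + 1))) {j : ℕ} (hj : M + 1 ≤ j) :
    longBlockCount S j = 0 := by
  have h := longBlockCount_mul_le S j
  by_contra hne
  have : 1 * (j + 1) ≤ longBlockCount S j * (j + 1) :=
    Nat.mul_le_mul_right _ (Nat.one_le_iff_ne_zero.2 hne)
  omega

/-- The mean of `longBlockCount` over the `k`-element sets of change points, divided by the length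
of the signal. -/
def meanLongBlocks (M k j : ℕ) : ℝ :=
  (∑ S ∈ (possibleChangePoints (M + 1)).powersetCard k, (longBlockCount S j : ℝ)) /
    (((M : ℝ) + 1) * (M.choose k : ℝ))

theorem card_possibleChangePoints (M : ℕ) : (possibleChangePoints (M + 1)).card = M := by
  have : possibleChangePoints (M + 1) = Finset.univ.erase 0 := by
    ext i
    simp only [possibleChangePoints, Finset.mem_filter, Finset.mem_univ, true_and,
      Finset.mem_erase, and_true, ← Fin.val_ne_zero_iff]
    omega
  rw [this, Finset.card_erase_of_mem (Finset.mem_univ _), Finset.card_univ, Fintype.card_fin]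
  rfl

theorem meanLongBlocks_nonneg (M k j : ℕ) : 0 ≤ meanLongBlocks M k j := by
  unfold meanLongBlocks; positivity

theorem meanLongBlocks_le (M k j : ℕ) : meanLongBlocks M k j ≤ 1 / ((j : ℝ) + 1) := by
  have h : ∑ S ∈ (possibleChangePoints (M + 1)).powersetCard k, (longBlockCount S j : ℝ) ≤
      (M.choose k : ℝ) * (((M : ℝ) + 1) / ((j : ℝ) + 1)) := by
    refine (Finset.sum_le_card_nsmul _ _ (((M : ℝ) + 1) / ((j : ℝ) + 1)) fun S _ => ?_).trans_eq ?_
    · rw [le_div_iff₀ (by positivity)]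
      exact_mod_cast longBlockCount_mul_le S j
    · rw [Finset.card_powersetCard, card_possibleChangePoints, nsmul_eq_mul]
  -- If there are no `k`-element sets, division by zero makes the mean `0`.
  rcases Nat.eq_zero_or_pos (M.choose k) with h0 | h0
  · rw [meanLongBlocks, h0]; simp; positivity
  · have : (0 : ℝ) < M.choose k := by exact_mod_cast h0
    rw [meanLongBlocks, div_le_iff₀ (by positivity)]
    refine h.trans_eq ?_
    ring

/-- The series form, with zero terms for `j ≥ N`, gives all signal lengths one common index set, as
dominated convergence requires. -/
theorem averageNormalizedSD_eq_tsum {N k : ℕ} (hN : 0 < N) (hk : 0 < k)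
    (x : Finset (Fin N) → EuclideanSpace ℝ (Fin N))
    (hx : ∀ S ∈ (possibleChangePoints N).powersetCard k,
      Monotone (fun i => x S i) ∧ changePoints (x S) = S) :
    averageNormalizedSD N k x = ∑' j : ℕ, meanLongBlocks (N - 1) k j / ((j : ℝ) + 1) := by
  obtain ⟨M, rfl⟩ : ∃ M, N = M + 1 := ⟨N - 1, by omega⟩
  rw [Nat.add_sub_cancel, tsum_eq_sum (s := Finset.range (M + 1))]
  · rw [averageNormalizedSD, Finset.card_powersetCard, card_possibleChangePoints]
    have h1 : ∀ S ∈ (possibleChangePoints (M + 1)).powersetCard k,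
        statDim (descentCone (monotoneTV (M + 1)) (x S)) / ((M + 1 : ℕ) : ℝ) =
          ∑ j ∈ Finset.range (M + 1), (longBlockCount S j : ℝ) / ((j : ℝ) + 1) / ((M : ℝ) + 1) := by
      intro S hS
      have hne : S.Nonempty := by
        rw [← Finset.card_pos, (Finset.mem_powersetCard.1 hS).2]; exact hk
      rw [descentCone_monotoneTV_eq (hx S hS).1, (hx S hS).2, statDim_cyclicCone_eq_sum hne,
        Finset.sum_div]
      push_cast
      rfl
    rw [Finset.sum_congr rfl h1, Finset.sum_comm, Finset.sum_div]
    refine Finset.sum_congr rfl fun j _ => ?_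
    rw [meanLongBlocks, ← Finset.sum_div, ← Finset.sum_div]
    simp only [div_div]
    ring
  · intro j hj
    rw [Finset.mem_range, not_lt] at hj
    simp [meanLongBlocks, longBlockCount_eq_zero _ hj]

/-! ### Averaging over random change points -/

theorem card_filter_powersetCard {α : Type*} [DecidableEq α] {P T : Finset α} {s : α} {k : ℕ}
    (hs : s ∈ P) (hT : T ⊆ P) (hsT : s ∉ T) (hk : 0 < k) :
    ((P.powersetCard k).filter fun S => s ∈ S ∧ Disjoint T S).card =
      (P.card - T.card - 1).choose (k - 1) := by
  have e : (P.powersetCard k).filter (fun S => s ∈ S ∧ Disjoint T S) =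
      (((P \ T).erase s).powersetCard (k - 1)).image (insert s) := by
    ext S
    simp only [Finset.mem_filter, Finset.mem_powersetCard, Finset.mem_image]
    constructor
    · rintro ⟨⟨h1, h2⟩, h3, h4⟩
      refine ⟨S.erase s, ⟨Finset.erase_subset_erase _ fun a ha => ?_, ?_⟩, Finset.insert_erase h3⟩
      · exact Finset.mem_sdiff.2 ⟨h1 ha, fun h => Finset.disjoint_left.1 h4 h ha⟩
      · rw [Finset.card_erase_of_mem h3, h2]
    · rintro ⟨U, ⟨h1, h2⟩, rfl⟩
      have hsU : s ∉ U := fun h => by simpa using h1 h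
      refine ⟨⟨?_, ?_⟩, Finset.mem_insert_self _ _, ?_⟩
      · refine Finset.insert_subset hs fun a ha => ?_
        exact (Finset.mem_sdiff.1 (Finset.mem_of_mem_erase (h1 ha))).1
      · rw [Finset.card_insert_of_notMem hsU, h2]; omega
      · rw [Finset.disjoint_insert_right]
        refine ⟨hsT, Finset.disjoint_left.2 fun a ha ha' => ?_⟩
        exact (Finset.mem_sdiff.1 (Finset.mem_of_mem_erase (h1 ha'))).2 ha
  rw [e, Finset.card_image_of_injOn, Finset.card_powersetCard, Finset.card_erase_of_mem,
    Finset.card_sdiff_of_subset hT]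
  · exact Finset.mem_sdiff.2 ⟨hs, hsT⟩
  · intro U hU U' hU' h
    rw [Finset.mem_coe, Finset.mem_powersetCard] at hU hU'
    have hsU : s ∉ U := fun h => by simpa using hU.1 h
    have hsU' : s ∉ U' := fun h => by simpa using hU'.1 h
    rw [← Finset.erase_insert hsU, ← Finset.erase_insert hsU']
    exact congrArg (fun X => X.erase s) h

-- The bounds on `s` keep the window `s, …, s + j` from wrapping around and from meeting position
-- `0`, so it consists of `j + 1` possible change points.
open Classical in
theorem card_filter_longBlock {M k j : ℕ} (hk : 0 < k) {s : Fin (M + 1)} (hs : 1 ≤ (s : ℕ))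
    (hsj : (s : ℕ) + j ≤ M) :
    (((possibleChangePoints (M + 1)).powersetCard k).filter fun S =>
      s ∈ S ∧ ∀ u, 1 ≤ u → u ≤ j → s + cyclicStep M u ∉ S).card = (M - j - 1).choose (k - 1) := by
  set T := (Finset.Icc 1 j).image fun u => s + cyclicStep M u with hT
  have hTc : T.card = j := by
    rw [hT, Finset.card_image_of_injOn, Nat.card_Icc, Nat.add_sub_cancel]
    intro u hu v hv h
    simp only [Finset.coe_Icc, Set.mem_Icc] at hu hv
    exact cyclicStep_injOn (by omega) (by omega) (add_left_cancel h)
  have hTP : T ⊆ possibleChangePoints (M + 1) := by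
    intro y hy
    simp only [hT, Finset.mem_image, Finset.mem_Icc] at hy
    obtain ⟨u, hu, rfl⟩ := hy
    simp only [possibleChangePoints, Finset.mem_filter, Finset.mem_univ, true_and, Fin.val_add]
    have : ((cyclicStep M u : Fin (M + 1)) : ℕ) = u := by
      simp [cyclicStep, Nat.mod_eq_of_lt (show u < M + 1 by omega)]
    rw [this, Nat.mod_eq_of_lt (by omega)]
    omega
  have hsT : s ∉ T := by
    simp only [hT, Finset.mem_image, Finset.mem_Icc, not_exists, not_and]
    intro u hu h
    have h0 : cyclicStep M u = cyclicStep M 0 := by rw [map_zero]; simpa using h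
    have := cyclicStep_injOn (by omega) (by omega) h0
    omega
  have hsP : s ∈ possibleChangePoints (M + 1) := by
    simp only [possibleChangePoints, Finset.mem_filter, Finset.mem_univ, true_and]; omega
  have := card_filter_powersetCard hsP hTP hsT hk
  rw [hTc, card_possibleChangePoints] at this
  rw [← this]
  congr 1
  refine Finset.filter_congr fun S _ => and_congr_right fun _ => ?_
  rw [Finset.disjoint_left]
  simp only [hT, Finset.mem_image, Finset.mem_Icc]
  constructor
  · rintro h y ⟨u, hu, rfl⟩
    exact h u hu.1 hu.2
  · exact fun h u h1 h2 => h ⟨u, ⟨h1, h2⟩, rfl⟩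

/-- The `M - j` starting points whose window avoids position `0` are counted exactly; the other `j +
1` cost at most one per set, which is negligible after division by `M + 1`. -/
theorem sum_longBlockCount_bounds {M k j : ℕ} (hk : 0 < k) (hj : j < M) :
    (M - j) * (M - j - 1).choose (k - 1) ≤
        ∑ S ∈ (possibleChangePoints (M + 1)).powersetCard k, longBlockCount S j ∧
      ∑ S ∈ (possibleChangePoints (M + 1)).powersetCard k, longBlockCount S j ≤
        (M - j) * (M - j - 1).choose (k - 1) + (j + 1) * M.choose k := by
  classical
  set K : Fin (M + 1) → ℕ := fun s =>
    (((possibleChangePoints (M + 1)).powersetCard k).filter fun S =>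
      s ∈ S ∧ ∀ u, 1 ≤ u → u ≤ j → s + cyclicStep M u ∉ S).card with hK
  set G : Finset (Fin (M + 1)) := Finset.univ.filter fun s => 1 ≤ (s : ℕ) ∧ (s : ℕ) + j ≤ M with hG
  have hsum : ∑ S ∈ (possibleChangePoints (M + 1)).powersetCard k, longBlockCount S j =
      ∑ s, K s := by
    simp only [hK, Finset.card_filter]
    rw [Finset.sum_comm]
    refine Finset.sum_congr rfl fun S _ => ?_
    rw [longBlockCount, ← Finset.card_filter]
    congr 1
    ext s; simp
  have hGc : G.card = M - j := by
    have : G.map Fin.valEmbedding = Finset.Icc 1 (M - j) := by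
      ext i
      simp only [hG, Finset.mem_map, Finset.mem_filter, Finset.mem_univ, true_and,
        Fin.valEmbedding_apply, Finset.mem_Icc]
      constructor
      · rintro ⟨s, hs, rfl⟩; omega
      · exact fun h => ⟨⟨i, by omega⟩, ⟨by simp; omega, by simp; omega⟩, rfl⟩
    rw [← Finset.card_map Fin.valEmbedding, this, Nat.card_Icc, Nat.add_sub_cancel]
  have hKG : ∑ s ∈ G, K s = (M - j) * (M - j - 1).choose (k - 1) := by
    rw [Finset.sum_congr rfl (g := fun _ => (M - j - 1).choose (k - 1)), Finset.sum_const, hGc,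
      smul_eq_mul]
    intro s hs
    simp only [hG, Finset.mem_filter, Finset.mem_univ, true_and] at hs
    exact card_filter_longBlock hk hs.1 hs.2
  have hKle : ∑ s ∈ Gᶜ, K s ≤ (j + 1) * M.choose k := by
    refine (Finset.sum_le_card_nsmul _ _ (M.choose k) fun s _ => ?_).trans_eq ?_
    · refine (Finset.card_filter_le _ _).trans_eq ?_
      rw [Finset.card_powersetCard, card_possibleChangePoints]
    · rw [Finset.card_compl, hGc, Fintype.card_fin, smul_eq_mul]
      congr 1
      omega
  rw [hsum, ← Finset.sum_add_sum_compl G K, hKG]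
  exact ⟨Nat.le_add_right _ _, Nat.add_le_add_left hKle _⟩

/-! ### Limits -/

/-- For `j = 0` the ratio is `k / M`. Passing from `j` to `j + 1` multiplies it by `(M - j - k) / (M
- j - 1)`, which tends to `1 - ε`. -/
theorem tendsto_choose_ratio {ε : ℝ} (hε0 : 0 < ε) (hε1 : ε < 1) {M k : ℕ → ℕ}
    (hM : Tendsto M atTop atTop) (hk : Tendsto (fun n => (k n : ℝ) / (M n : ℝ)) atTop (𝓝 ε))
    (j : ℕ) : Tendsto (fun n => ((M n - j - 1).choose (k n - 1) : ℝ) / ((M n).choose (k n) : ℝ))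
      atTop (𝓝 (ε * (1 - ε) ^ j)) := by
  have hk0 : ∀ᶠ n in atTop, 0 < k n := by
    filter_upwards [hk.eventually_const_lt hε0] with n hn
    rcases Nat.eq_zero_or_pos (k n) with h | h
    · simp [h] at hn
    · exact h
  have hkM : ∀ᶠ n in atTop, k n < M n := by
    filter_upwards [hk.eventually_lt_const hε1, hM.eventually_gt_atTop 0] with n hn h0
    rw [div_lt_one (by exact_mod_cast h0)] at hn
    exact_mod_cast hn
  have hinv : Tendsto (fun n => 1 / (M n : ℝ)) atTop (𝓝 0) :=
    tendsto_one_div_atTop_nhds_zero_nat.comp hM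
  induction j with
  | zero =>
    rw [pow_zero, mul_one]
    refine hk.congr' ?_
    filter_upwards [hk0, hkM] with n h1 h2
    obtain ⟨a, ha⟩ : ∃ a, k n = a + 1 := ⟨k n - 1, by omega⟩
    obtain ⟨b, hb⟩ : ∃ b, M n = b + 1 := ⟨M n - 1, by omega⟩
    have h3 : 0 < (b + 1).choose (a + 1) := Nat.choose_pos (by omega)
    have h4 := Nat.add_one_mul_choose_eq b a
    rw [ha, hb]
    simp only [Nat.sub_zero, Nat.add_sub_cancel]
    have h5 : (((b + 1).choose (a + 1) : ℕ) : ℝ) ≠ 0 := by positivity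
    have h6 : (((b + 1 : ℕ)) : ℝ) ≠ 0 := by positivity
    rw [div_eq_div_iff h6 h5]
    exact_mod_cast (by linarith : (a + 1) * (b + 1).choose (a + 1) = b.choose a * (b + 1))
  | succ j ih =>
    have hlim : Tendsto (fun n => (1 - j * (1 / (M n : ℝ)) - (k n : ℝ) / (M n : ℝ)) /
        (1 - ((j : ℝ) + 1) * (1 / (M n : ℝ)))) atTop (𝓝 (1 - ε)) := by
      have := ((tendsto_const_nhds (x := (1 : ℝ))).sub (hinv.const_mul (j : ℝ))).sub hk
      have h2 := (tendsto_const_nhds (x := (1 : ℝ))).sub (hinv.const_mul ((j : ℝ) + 1))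
      have := this.div h2 (by simp)
      simpa [Pi.div_def] using this
    rw [pow_succ, ← mul_assoc]
    refine (ih.mul hlim).congr' ?_
    filter_upwards [hk0, hkM, hM.eventually_gt_atTop (j + 1)] with n h1 h2 h3
    obtain ⟨a, ha⟩ : ∃ a, k n = a + 1 := ⟨k n - 1, by omega⟩
    obtain ⟨b, hb⟩ : ∃ b, M n = b + (j + 2) := ⟨M n - (j + 2), by omega⟩
    have h4 := Nat.choose_mul_succ_eq b a
    -- The real form of `h4`. For `a > b + 1` the natural subtraction in `h4` truncates, but both
    -- binomials vanish.
    have h5 : (b.choose a : ℝ) * ((b : ℝ) + 1) = ((b + 1).choose a : ℝ) * ((b : ℝ) + 1 - a) := by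
      rcases Nat.le_total a (b + 1) with h | h
      · rw [← Nat.cast_inj (R := ℝ)] at h4
        push_cast [Nat.cast_sub h] at h4
        exact h4
      · rcases h.eq_or_lt with h | h
        · subst h
          simp
        · rw [Nat.choose_eq_zero_of_lt h, Nat.choose_eq_zero_of_lt (by omega : b < a)]
          simp
    have hc : ((M n).choose (k n) : ℝ) ≠ 0 := by
      exact_mod_cast (Nat.choose_pos h2.le).ne'
    rw [show M n - j - 1 = b + 1 by omega, show M n - (j + 1) - 1 = b by omega,
      show k n - 1 = a by omega]
    have hb0 : (b : ℝ) + 1 ≠ 0 := by positivity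
    have hM0 : (M n : ℝ) ≠ 0 := by
      have : 0 < M n := by omega
      positivity
    have e1 : (1 - j * (1 / (M n : ℝ)) - (k n : ℝ) / (M n : ℝ)) /
        (1 - ((j : ℝ) + 1) * (1 / (M n : ℝ))) = ((b : ℝ) + 1 - a) / ((b : ℝ) + 1) := by
      have : (1 - ((j : ℝ) + 1) * (1 / (M n : ℝ))) = ((b : ℝ) + 1) / M n := by
        rw [eq_div_iff hM0]
        field_simp
        rw [hb]; push_cast; ring
      rw [this, div_div_eq_mul_div]
      congr 1
      field_simp
      rw [hb, ha]; push_cast; ring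
    rw [e1, div_mul_div_comm, ← h5, mul_div_mul_right _ _ hb0]

theorem tendsto_meanLongBlocks {ε : ℝ} (hε0 : 0 < ε) (hε1 : ε < 1) {M k : ℕ → ℕ}
    (hM : Tendsto M atTop atTop) (hk : Tendsto (fun n => (k n : ℝ) / (M n : ℝ)) atTop (𝓝 ε))
    (j : ℕ) : Tendsto (fun n => meanLongBlocks (M n) (k n) j) atTop (𝓝 (ε * (1 - ε) ^ j)) := by
  have hr := tendsto_choose_ratio hε0 hε1 hM hk j
  have hinv : Tendsto (fun n => 1 / ((M n : ℝ) + 1)) atTop (𝓝 0) :=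
    tendsto_one_div_add_atTop_nhds_zero_nat.comp hM
  have hfrac : Tendsto (fun n => 1 - ((j : ℝ) + 1) * (1 / ((M n : ℝ) + 1))) atTop (𝓝 1) := by
    simpa using (tendsto_const_nhds (x := (1 : ℝ))).sub (hinv.const_mul ((j : ℝ) + 1))
  have hlow := hfrac.mul hr
  have hup := hlow.add (hinv.const_mul ((j : ℝ) + 1))
  rw [one_mul] at hlow
  rw [one_mul, mul_zero, add_zero] at hup
  have hev : ∀ᶠ n in atTop, 0 < k n ∧ k n < M n ∧ j < M n := by
    filter_upwards [hk.eventually_const_lt hε0, hk.eventually_lt_const hε1,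
      hM.eventually_gt_atTop j] with n h1 h2 h3
    have h0 : (0 : ℝ) < M n := by exact_mod_cast (by omega : 0 < M n)
    rw [div_lt_one h0] at h2
    refine ⟨?_, by exact_mod_cast h2, h3⟩
    rw [lt_div_iff₀ h0, zero_mul] at h1
    exact_mod_cast h1
  have hbound (n : ℕ) (h : 0 < k n ∧ k n < M n ∧ j < M n) :
      (1 - ((j : ℝ) + 1) * (1 / ((M n : ℝ) + 1))) *
        (((M n - j - 1).choose (k n - 1) : ℝ) / ((M n).choose (k n) : ℝ)) ≤
        meanLongBlocks (M n) (k n) j ∧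
      meanLongBlocks (M n) (k n) j ≤ (1 - ((j : ℝ) + 1) * (1 / ((M n : ℝ) + 1))) *
        (((M n - j - 1).choose (k n - 1) : ℝ) / ((M n).choose (k n) : ℝ)) +
        ((j : ℝ) + 1) * (1 / ((M n : ℝ) + 1)) := by
    obtain ⟨h1, h2, h3⟩ := h
    obtain ⟨hl, hu⟩ := sum_longBlockCount_bounds h1 h3
    have hc : (0 : ℝ) < (M n).choose (k n) := by exact_mod_cast Nat.choose_pos h2.le
    have hM1 : (0 : ℝ) < (M n : ℝ) + 1 := by positivity
    rw [← Nat.cast_le (α := ℝ)] at hl hu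
    push_cast [Nat.cast_sub h3.le] at hl hu
    rw [meanLongBlocks, le_div_iff₀ (by positivity), div_le_iff₀ (by positivity)]
    refine ⟨le_trans (le_of_eq ?_) hl, hu.trans (le_of_eq ?_)⟩
    · field_simp; ring
    · field_simp; ring
  refine tendsto_of_tendsto_of_tendsto_of_le_of_le' hlow hup ?_ ?_
  · filter_upwards [hev] with n h using (hbound n h).1
  · filter_upwards [hev] with n h using (hbound n h).2

/-- The series of `-log (1 - x)` at `x = 1 - ε`, multiplied by `ε / (1 - ε)`. -/
theorem tsum_geometric_div {ε : ℝ} (hε0 : 0 < ε) (hε1 : ε < 1) :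
    ∑' j : ℕ, ε * (1 - ε) ^ j / ((j : ℝ) + 1) = ε * Real.log (1 / ε) / (1 - ε) := by
  have h := Real.hasSum_pow_div_log_of_abs_lt_one (x := 1 - ε)
    (by rw [abs_of_pos (by linarith)]; linarith)
  have h1 : (1 - ε) ≠ 0 := by linarith
  have h2 := (h.mul_left (ε / (1 - ε))).tsum_eq
  rw [sub_sub_cancel] at h2
  rw [one_div, Real.log_inv, mul_div_right_comm, ← h2]
  refine tsum_congr fun j => ?_
  rw [pow_succ]
  field_simp

end

theorem mainTheorem2 (ε : ℝ) (hε0 : 0 < ε) (hε1 : ε < 1) (N k : ℕ → ℕ)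
    (hN : Tendsto N atTop atTop)
    (hk : Tendsto (fun n => (k n : ℝ) / (N n : ℝ)) atTop (𝓝 ε))
    (x : (n : ℕ) → Finset (Fin (N n)) → EuclideanSpace ℝ (Fin (N n)))
    (hx : ∀ n, ∀ S ∈ (possibleChangePoints (N n)).powersetCard (k n),
      Monotone (fun i => x n S i) ∧ changePoints (x n S) = S) :
    Tendsto (fun n => averageNormalizedSD (N n) (k n) (x n)) atTop
      (𝓝 (ε * Real.log (1 / ε) / (1 - ε))) := by
  have hM : Tendsto (fun n => N n - 1) atTop atTop := (tendsto_sub_atTop_nat 1).comp hN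
  -- Only `N - 1` positions can be change points; the density has the same limit relative to that
  -- number.
  have hkM : Tendsto (fun n => (k n : ℝ) / ((N n - 1 : ℕ) : ℝ)) atTop (𝓝 ε) := by
    have hinv : Tendsto (fun n => 1 / (N n : ℝ)) atTop (𝓝 0) :=
      tendsto_one_div_atTop_nhds_zero_nat.comp hN
    have h1 := hk.div ((tendsto_const_nhds (x := (1 : ℝ))).sub hinv) (by simp)
    rw [sub_zero, div_one] at h1
    refine h1.congr' ?_
    filter_upwards [hN.eventually_gt_atTop 1] with n hn
    have h0 : (N n : ℝ) ≠ 0 := by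
      have : 0 < N n := by omega
      positivity
    simp only [Pi.div_apply]
    rw [Nat.cast_sub hn.le, div_div, mul_sub, mul_one_div_cancel h0]
    simp
  rw [← tsum_geometric_div hε0 hε1]
  have hlim : Tendsto (fun n => ∑' j : ℕ, meanLongBlocks (N n - 1) (k n) j / ((j : ℝ) + 1)) atTop
      (𝓝 (∑' j : ℕ, ε * (1 - ε) ^ j / ((j : ℝ) + 1))) := by
    -- One factor `1 / (j + 1)` comes from the disjoint windows, the other from the harmonic weight.
    have hsum : Summable fun j : ℕ => 1 / ((j : ℝ) + 1) ^ 2 := by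
      have := (summable_nat_add_iff 1).2 (Real.summable_one_div_nat_pow.2 (by norm_num : 1 < 2))
      simpa using this
    refine tendsto_tsum_of_dominated_convergence hsum
      (fun j => (tendsto_meanLongBlocks hε0 hε1 hM hkM j).div_const _)
      (Eventually.of_forall fun n j => ?_)
    have hj : (0 : ℝ) < (j : ℝ) + 1 := by positivity
    rw [Real.norm_of_nonneg (div_nonneg (meanLongBlocks_nonneg _ _ _) hj.le), sq, ← div_div]
    exact div_le_div_of_nonneg_right (meanLongBlocks_le _ _ _) hj.le
  refine hlim.congr' ?_
  filter_upwards [hN.eventually_gt_atTop 0, hk.eventually_const_lt hε0] with n h1 h2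
  have h3 : 0 < k n := by
    rcases Nat.eq_zero_or_pos (k n) with h | h
    · simp [h] at h2
    · exact h
  exact (averageNormalizedSD_eq_tsum h1 h3 (x n) (hx n)).symm
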